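/- Let $N\ge 1$. For $0<\varepsilon<1/2$ and $r_0>0$, an $(\varepsilon,r_0)$-Reifenberg-flat domain is a bounded, connected, open set $\Omega\subset\mathbb R^N$ such that: (i) for every $x\in\partial\Omega$ and every $0<r\le r_0$ there is a hyperplane $P(x,r)$ through $x$ with $\frac1r d_H\big(\partial\Omega\cap B(x,r),\,P(x,r)\cap B(x,r)\big)\le\varepsilon$, where $d_H$ is the Hausdorff distance; (ii) for every $x\in\partial\Omega$, one of the two connected components of $B(x,r_0)\cap\{y:\ d(y,P(x,r_0))\ge 2\varepsilon r_0\}$ is contained in $\Omega$ and the other one in $\mathbb R^N\setminus\Omega$. **Theorem.** For every $N\ge1$ and $\alpha>0$ there is an $\varepsilon=\varepsilon(N,\alpha)\in(0,1/2)$ such that the following holds. Let $p,q,p_0\in[1,\infty]$ satisfy $\frac1p+\frac1q=\frac1{p_0}$, $p_0>\frac N2$ and $$\alpha<\frac{p_0-\frac N2}{p_0}=1-\frac{N}{2p_0}$$ (the right-hand side is $1$ if $p_0=\infty$). Let $\Omega\subset\mathbb R^N$ be an $(\varepsilon,r_0)$-Reifenberg-flat domain for some $r_0>0$, let $f\in L^q(\Omega)$,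 and let $u\in W^{1,2}_0(\Omega)\cap L^p(\Omega)$ be a weak solution of $-\Delta u=f$ in $\Omega$, $u=0$ on $\partial\Omega$, that is, $\int_\Omega\nabla u\cdot\nabla\varphi\,dx=\int_\Omega f\varphi\,dx$ for all $\varphi\in C_c^\infty(\Omega)$. Then $u$, after modification on a null set of $\Omega$ and with the value $0$ on $\partial\Omega$, satisfies $$u\in C^{0,\alpha}\big(B(x,r_0/12)\cap\overline\Omega\big)\qquad\text{for all }x\in\overline\Omega,$$ and $$\|u\|_{C^{0,\alpha}(B(x,r_0/12)\cap\overline\Omega)}\le C\qquad\text{for all }x\in\overline\Omega,$$ where $C$ depends only on $N$, $r_0$, $\alpha$, $p_0$, $\|u\|_{L^p(\Omega)}$ and $\|f\|_{L^q(\Omega)}$. Here $\|u\|_{C^{0,\alpha}(S)}=\sup_S|u|+\sup_{y\ne z\in S}\frac{|u(y)-u(z)|}{|y-z|^\alpha}$. -/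

import Mathlib

open MeasureTheory
open scoped ENNReal ContDiff

noncomputable section

/-- The hyperplane of `ℝ^N` through `x` with (unit) normal vector `ν`. -/
def hyperplane {N : ℕ} (x ν : EuclideanSpace ℝ (Fin N)) : Set (EuclideanSpace ℝ (Fin N)) :=
  {y | inner ℝ ν (y - x) = 0}

/-- The part of the open ball `B(x, r)` on the side of `ν`, at distance at least `t` from the
hyperplane through `x` with unit normal `ν`. For `0 < t < r` the set
`B(x, r) ∩ {y ; d(y, P) ≥ t}` has exactly two connected components (both are convex):
`cap x ν r t` and `cap x (-ν) r t`. -/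
def cap {N : ℕ} (x ν : EuclideanSpace ℝ (Fin N)) (r t : ℝ) : Set (EuclideanSpace ℝ (Fin N)) :=
  Metric.ball x r ∩ {y | t ≤ inner ℝ ν (y - x)}

/-- `(ε, r₀)`-Reifenberg-flat domains of `ℝ^N`. The hyperplane `P(x, r)` is the one through `x`
with unit normal `ν x r`. -/
structure IsReifenbergFlatDomain {N : ℕ} (ε r₀ : ℝ) (Ω : Set (EuclideanSpace ℝ (Fin N))) :
    Prop where
  eps_pos : 0 < ε
  eps_lt : ε < 1 / 2
  radius_pos : 0 < r₀
  isOpen : IsOpen Ω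
  isBounded : Bornology.IsBounded Ω
  isConnected : IsConnected Ω
  flat : ∃ ν : EuclideanSpace ℝ (Fin N) → ℝ → EuclideanSpace ℝ (Fin N),
    (∀ x ∈ frontier Ω, ∀ r : ℝ, 0 < r → r ≤ r₀ →
      ‖ν x r‖ = 1 ∧
      1 / r * Metric.hausdorffDist (frontier Ω ∩ Metric.ball x r)
        (hyperplane x (ν x r) ∩ Metric.ball x r) ≤ ε) ∧
    ∀ x ∈ frontier Ω,
      (cap x (ν x r₀) r₀ (2 * ε * r₀) ⊆ Ω ∧ cap x (-ν x r₀) r₀ (2 * ε * r₀) ⊆ Ωᶜ) ∨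
      (cap x (-ν x r₀) r₀ (2 * ε * r₀) ⊆ Ω ∧ cap x (ν x r₀) r₀ (2 * ε * r₀) ⊆ Ωᶜ)

/-- Test functions: `φ ∈ C_c^∞(Ω)`. -/
structure IsTestFunction {N : ℕ} (Ω : Set (EuclideanSpace ℝ (Fin N)))
    (φ : EuclideanSpace ℝ (Fin N) → ℝ) : Prop where
  smooth : ContDiff ℝ ∞ φ
  hasCompactSupport : HasCompactSupport φ
  tsupport_subset : tsupport φ ⊆ Ω

/-- `G` is the weak gradient of `u` in `Ω`. -/
def HasWeakGradient {N : ℕ} (Ω : Set (EuclideanSpace ℝ (Fin N)))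
    (u : EuclideanSpace ℝ (Fin N) → ℝ)
    (G : EuclideanSpace ℝ (Fin N) → EuclideanSpace ℝ (Fin N)) : Prop :=
  ∀ φ : EuclideanSpace ℝ (Fin N) → ℝ, IsTestFunction Ω φ → ∀ i : Fin N,
    ∫ x in Ω, u x * (gradient φ x) i = - ∫ x in Ω, (G x) i * φ x

/-- `u ∈ W^{1,2}_0(Ω)` with weak gradient `G`: the function `u` lies in `W^{1,2}(Ω)` and in the
closure of `C_c^∞(Ω)` for the norm of `W^{1,2}(Ω)`. -/
structure IsSobolevZero {N : ℕ} (Ω : Set (EuclideanSpace ℝ (Fin N)))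
    (u : EuclideanSpace ℝ (Fin N) → ℝ)
    (G : EuclideanSpace ℝ (Fin N) → EuclideanSpace ℝ (Fin N)) : Prop where
  memLp : MemLp u 2 (volume.restrict Ω)
  memLp_grad : MemLp G 2 (volume.restrict Ω)
  hasWeakGradient : HasWeakGradient Ω u G
  approx : ∀ δ : ℝ≥0∞, 0 < δ → ∃ φ : EuclideanSpace ℝ (Fin N) → ℝ, IsTestFunction Ω φ ∧
    eLpNorm (fun x => u x - φ x) 2 (volume.restrict Ω) < δ ∧
    eLpNorm (fun x => G x - gradient φ x) 2 (volume.restrict Ω) < δ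

/-- `u ∈ W^{1,2}_0(Ω)` is a weak solution of `-Δu = f` in `Ω`, `u = 0` on `∂Ω`. -/
def IsWeakSolution {N : ℕ} (Ω : Set (EuclideanSpace ℝ (Fin N)))
    (f u : EuclideanSpace ℝ (Fin N) → ℝ) : Prop :=
  ∃ G : EuclideanSpace ℝ (Fin N) → EuclideanSpace ℝ (Fin N), IsSobolevZero Ω u G ∧
    ∀ φ : EuclideanSpace ℝ (Fin N) → ℝ, IsTestFunction Ω φ →
      ∫ x in Ω, inner ℝ (G x) (gradient φ x) = ∫ x in Ω, f x * φ x

/-- The norm of `C^{0,α}(S)`: the supremum of `|v|` on `S` plus the least Hölder constant of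
`v` on `S`; it is `∞` when `v` is unbounded or not Hölder continuous on `S`. -/
def holderNormOn {N : ℕ} (α : ℝ) (S : Set (EuclideanSpace ℝ (Fin N)))
    (v : EuclideanSpace ℝ (Fin N) → ℝ) : ℝ≥0∞ :=
  (⨆ y ∈ S, ‖v y‖ₑ) + eHolderNorm α.toNNReal (S.domRestrict v)

/-- `v ∈ C^{0,α}(S)`. -/
def MemHolderOn {N : ℕ} (α : ℝ) (S : Set (EuclideanSpace ℝ (Fin N)))
    (v : EuclideanSpace ℝ (Fin N) → ℝ) : Prop :=
  holderNormOn α S v < ⊤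

end

/-!
The proof compares the solution with explicit smooth radial kernels, without Sobolev theory,
fundamental solutions or monotonicity formulas.

Let `ψ` be a smooth nonincreasing function with `ψ = 0` on `[1, ∞)`. The kernels
`potKer s x y = s⁻ᴺ ψ(|y - x|²/s²)` and `avgKer s x y = -2 s⁻ᴺ ψ'(|y - x|²/s²)` satisfy
`∂ₛ avgKer = s Δ potKer` (`hasDerivAt_avgKer`). Hence the derivative in `s` of the smoothed
average `smoothAvg Ω w x s` of a function `w` is `s ∫ w Δ(potKer s x)`, which an equation for `Δw`
turns into an integral of the right-hand side. The hypothesis `1/p + 1/q = 1/p₀` gives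
`∫_{Ω ∩ B(x,R)} |f| ≤ Λ R^(N-2+γ)` with `γ = 2 - N/p₀ > 2α` (`morreyData_of_memLp`), so that the
contribution of `f` at scale `s` is of the order of `s^γ`.

Near the boundary the equation is used for `|u|` extended by zero: this is a subsolution,
`-Δ|u| ≤ |f|`, in the whole space, and the test function need only be nonnegative on `Ω`
(`IsWeakSolution.neg_integral_lap_abs_le`). By Reifenberg flatness and a connectedness argument,
in every ball `B(x₀, r)` with `x₀ ∈ ∂Ω` and `r = θ^k r₀` the domain lies, up to an error `2εr`, on
one side of a hyperplane (`IsReifenbergFlatDomain.one_sided`). If `x'` is the mirror image of `x`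
in this (slightly shifted) hyperplane, then `potKer s x - potKer s x'` is nonnegative on `Ω`, and
the difference of the smoothed averages of `|u|` at `x` and `x'` is almost monotone in the scale.
At small scales it is the average at `x`; at scale `r/4` it is at most a constant times
`(|x - x'| / r) sup_{B(x₀,r)} |u|`. So `sup |u|` over `B(x₀, θr)` is at most
`c (θ + 2ε) sup_{B(x₀,r)} |u|` plus a multiple of `r^γ` (`MorreyData.decay_step`). As `α < 1`, the
choice of `θ` and then of `ε` small makes the factor at most `θ^α / 2`, and iteration gives
`|u(x)| ≤ B |x - x₀|^α` (`decay_of_step`).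

In the interior the difference of the smoothed averages of `u` at two points is compared across
scales in the same way (`MorreyData.abs_smoothAvg_sub_le`). Together with the decay at the
boundary this yields the Hölder estimate (`MorreyData.holder_of_decay`). The representative `v` is
a limit of smoothed averages (`IsPreciseRep`), so every estimate holds at every point.
-/

section

open Set Filter Topology

/-! ### The Laplacian in coordinates -/

/-- The Laplacian `∑ i, ∂ᵢ ∂ᵢ φ`, written with the coordinates of gradients that occur in
`HasWeakGradient`. -/
noncomputable def lap {N : ℕ} (φ : EuclideanSpace ℝ (Fin N) → ℝ)
    (x : EuclideanSpace ℝ (Fin N)) : ℝ :=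
  ∑ i, gradient (fun y => gradient φ y i) x i

theorem gradient_apply_eq_fderiv {N : ℕ} (φ : EuclideanSpace ℝ (Fin N) → ℝ)
    (x : EuclideanSpace ℝ (Fin N)) (i : Fin N) :
    gradient φ x i = fderiv ℝ φ x (EuclideanSpace.single i 1) := by
  have h := InnerProductSpace.toDual_symm_apply (𝕜 := ℝ) (x := EuclideanSpace.single i (1 : ℝ))
    (y := fderiv ℝ φ x)
  rw [← h, EuclideanSpace.inner_single_right]
  simp [gradient]

theorem gradient_contDiff_apply {N : ℕ} {φ : EuclideanSpace ℝ (Fin N) → ℝ}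
    (hφ : ContDiff ℝ ∞ φ) (i : Fin N) : ContDiff ℝ ∞ (fun y => gradient φ y i) := by
  simp_rw [gradient_apply_eq_fderiv]
  exact (hφ.fderiv_right (m := ∞) (by simp)).clm_apply contDiff_const

theorem tsupport_gradient_apply_subset {N : ℕ} (φ : EuclideanSpace ℝ (Fin N) → ℝ) (i : Fin N) :
    tsupport (fun y => gradient φ y i) ⊆ tsupport φ := by
  simp_rw [gradient_apply_eq_fderiv]
  exact tsupport_fderiv_apply_subset ℝ _

theorem lap_contDiff {N : ℕ} {φ : EuclideanSpace ℝ (Fin N) → ℝ} (hφ : ContDiff ℝ ∞ φ) :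
    ContDiff ℝ ∞ (lap φ) := by
  unfold lap
  exact ContDiff.sum fun i _ => gradient_contDiff_apply (gradient_contDiff_apply hφ i) i

theorem lap_continuous {N : ℕ} {φ : EuclideanSpace ℝ (Fin N) → ℝ} (hφ : ContDiff ℝ ∞ φ) :
    Continuous (lap φ) := (lap_contDiff hφ).continuous

theorem lap_hasCompactSupport {N : ℕ} {φ : EuclideanSpace ℝ (Fin N) → ℝ}
    (hφ : HasCompactSupport φ) : HasCompactSupport (lap φ) := by
  refine HasCompactSupport.of_support_subset_isCompact hφ fun x hx => ?_
  by_contra hne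
  refine hx (Finset.sum_eq_zero fun i _ => ?_)
  have h := fun h' => hne (tsupport_gradient_apply_subset φ i
    (tsupport_gradient_apply_subset _ i (subset_tsupport _ h')))
  simpa using h

theorem gradient_sub_mul_apply {N : ℕ} {φ χ : EuclideanSpace ℝ (Fin N) → ℝ} (c : ℝ)
    {x : EuclideanSpace ℝ (Fin N)}
    (hφ : DifferentiableAt ℝ φ x) (hχ : DifferentiableAt ℝ χ x) (i : Fin N) :
    gradient (fun y => φ y - c * χ y) x i = gradient φ x i - c * gradient χ x i := by
  simp_rw [gradient_apply_eq_fderiv]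
  rw [fderiv_fun_sub hφ (hχ.const_mul c), fderiv_const_mul hχ]
  simp

theorem lap_sub_mul {N : ℕ} {φ χ : EuclideanSpace ℝ (Fin N) → ℝ} (c : ℝ)
    (hφ : ContDiff ℝ ∞ φ) (hχ : ContDiff ℝ ∞ χ) (x : EuclideanSpace ℝ (Fin N)) :
    lap (fun y => φ y - c * χ y) x = lap φ x - c * lap χ x := by
  unfold lap
  rw [Finset.mul_sum, ← Finset.sum_sub_distrib]
  refine Finset.sum_congr rfl fun i _ => ?_
  have h : (fun y => gradient (fun z => φ z - c * χ z) y i) =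
      fun y => gradient φ y i - c * gradient χ y i := by
    funext y
    exact gradient_sub_mul_apply c (hφ.differentiable (by simp) y)
      (hχ.differentiable (by simp) y) i
  rw [h]
  exact gradient_sub_mul_apply c ((gradient_contDiff_apply hφ i).differentiable (by simp) x)
    ((gradient_contDiff_apply hχ i).differentiable (by simp) x) i

/-- The Laplacian of a radial function. -/
theorem lap_radial {N : ℕ} {g : ℝ → ℝ} (hg : ContDiff ℝ ∞ g) (a c : ℝ)
    (x y : EuclideanSpace ℝ (Fin N)) :
    lap (fun z => a * g (c * ‖z - x‖ ^ 2)) y =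
      a * (4 * c ^ 2 * ‖y - x‖ ^ 2 * deriv (deriv g) (c * ‖y - x‖ ^ 2)
        + 2 * c * N * deriv g (c * ‖y - x‖ ^ 2)) := by
  have hg' : ContDiff ℝ ∞ (deriv g) := hg.iterate_deriv 1
  have key : ∀ {h : ℝ → ℝ}, ContDiff ℝ ∞ h → ∀ z : EuclideanSpace ℝ (Fin N),
      HasFDerivAt (fun z => h (c * ‖z - x‖ ^ 2))
        (deriv h (c * ‖z - x‖ ^ 2) • c • (2 : ℕ) • innerSL ℝ (z - x)) z := by
    intro h hh z
    have h1 : HasFDerivAt (fun z : EuclideanSpace ℝ (Fin N) => c * ‖z - x‖ ^ 2)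
        (c • (2 : ℕ) • innerSL ℝ (z - x)) z := by
      have := (((hasFDerivAt_id z).sub_const x).norm_sq).const_mul c
      simpa using this
    exact ((hh.differentiable (by simp)) _).hasDerivAt.comp_hasFDerivAt z h1
  have h1 : ∀ i, (fun z => gradient (fun z => a * g (c * ‖z - x‖ ^ 2)) z i) =
      fun z => (2 * a * c) * (deriv g (c * ‖z - x‖ ^ 2) * (z i - x i)) := by
    intro i
    funext z
    rw [gradient_apply_eq_fderiv, ((key hg z).const_mul a).fderiv]
    simp [EuclideanSpace.inner_single_right]
    ring
  have h2 : ∀ i, gradient (fun z => gradient (fun z => a * g (c * ‖z - x‖ ^ 2)) z i) y i =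
      4 * a * c ^ 2 * deriv (deriv g) (c * ‖y - x‖ ^ 2) * (y i - x i) ^ 2
        + 2 * a * c * deriv g (c * ‖y - x‖ ^ 2) := by
    intro i
    rw [h1 i, gradient_apply_eq_fderiv]
    have h3 : HasFDerivAt (fun z : EuclideanSpace ℝ (Fin N) => z i - x i)
        (EuclideanSpace.proj i : EuclideanSpace ℝ (Fin N) →L[ℝ] ℝ) y :=
      (EuclideanSpace.proj i : EuclideanSpace ℝ (Fin N) →L[ℝ] ℝ).hasFDerivAt.sub_const _
    have h4 : HasFDerivAt (fun z => 2 * a * c * (deriv g (c * ‖z - x‖ ^ 2) * (z i - x i))) _ y :=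
      ((key hg' y).mul h3).const_mul (2 * a * c)
    rw [h4.fderiv]
    simp [EuclideanSpace.inner_single_right]
    ring
  unfold lap
  simp_rw [h2]
  rw [Finset.sum_add_distrib, ← Finset.mul_sum]
  have h4 : ‖y - x‖ ^ 2 = ∑ i, (y i - x i) ^ 2 := by
    rw [EuclideanSpace.norm_sq_eq]; simp
  rw [← h4]
  simp
  ring

/-! ### Radial kernels -/

/-- A smooth nonincreasing profile, `1` on `(-∞, 0]` and `0` on `[1, ∞)`. -/
noncomputable def profile (t : ℝ) : ℝ := Real.smoothTransition (1 - t)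

theorem profile_contDiff : ContDiff ℝ ∞ profile :=
  Real.smoothTransition.contDiff.comp (contDiff_const.sub contDiff_id)

theorem profile_antitone : Antitone profile := fun _ _ h =>
  Real.smoothTransition.monotone (by linarith)

theorem profile_nonneg (t : ℝ) : 0 ≤ profile t := Real.smoothTransition.nonneg _

theorem profile_le_one (t : ℝ) : profile t ≤ 1 := Real.smoothTransition.le_one _

theorem profile_eq_zero {t : ℝ} (ht : 1 ≤ t) : profile t = 0 :=
  Real.smoothTransition.zero_of_nonpos (by linarith)

theorem deriv_profile_nonpos (t : ℝ) : deriv profile t ≤ 0 :=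
  profile_antitone.deriv_nonpos

theorem contDiff_deriv_profile : ContDiff ℝ ∞ (deriv profile) := profile_contDiff.iterate_deriv 1

theorem contDiff_deriv_deriv_profile : ContDiff ℝ ∞ (deriv (deriv profile)) :=
  profile_contDiff.iterate_deriv 2

/-- A function that vanishes beyond `1` has derivative zero on the closed half-line `[1, ∞)`;
continuity of the derivative gives the endpoint. -/
theorem deriv_eq_zero_of_eq_zero_of_one_le {g : ℝ → ℝ} (hg : ContDiff ℝ ∞ g)
    (h : ∀ t, 1 ≤ t → g t = 0) {t : ℝ} (ht : 1 ≤ t) : deriv g t = 0 := by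
  have hd := (hg.differentiable (by simp) t).hasDerivAt
  have h0 : HasDerivWithinAt g 0 (Ici t) t :=
    (hasDerivWithinAt_const t (Ici t) (0 : ℝ)).congr (fun s hs => h s (ht.trans hs)) (h t ht)
  exact (uniqueDiffWithinAt_Ici t).eq_deriv _ hd.hasDerivWithinAt h0

theorem deriv_profile_eq_zero {t : ℝ} (ht : 1 ≤ t) : deriv profile t = 0 :=
  deriv_eq_zero_of_eq_zero_of_one_le profile_contDiff (fun _ => profile_eq_zero) ht

theorem deriv_deriv_profile_eq_zero {t : ℝ} (ht : 1 ≤ t) : deriv (deriv profile) t = 0 :=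
  deriv_eq_zero_of_eq_zero_of_one_le contDiff_deriv_profile (fun _ => deriv_profile_eq_zero) ht

theorem exists_deriv_profile_ne_zero : ∃ t, 0 < t ∧ deriv profile t ≠ 0 := by
  obtain ⟨t, ht, h⟩ := exists_deriv_eq_slope profile zero_lt_one
    profile_contDiff.continuous.continuousOn
    (profile_contDiff.differentiable (by simp)).differentiableOn
  refine ⟨t, ht.1, ?_⟩
  rw [h, profile_eq_zero le_rfl]
  simp [profile]

/-- The potential kernel `y ↦ s⁻ᴺ ψ(|y - x|² / s²)` at scale `s`, with `ψ` the profile. -/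
noncomputable def potKer {N : ℕ} (s : ℝ) (x y : EuclideanSpace ℝ (Fin N)) : ℝ :=
  (s ^ N)⁻¹ * profile ((s ^ 2)⁻¹ * ‖y - x‖ ^ 2)

/-- The averaging kernel `y ↦ -2 s⁻ᴺ ψ'(|y - x|² / s²)` at scale `s`, with `ψ` the profile; its
derivative in `s` is `s` times the Laplacian of the potential kernel. -/
noncomputable def avgKer {N : ℕ} (s : ℝ) (x y : EuclideanSpace ℝ (Fin N)) : ℝ :=
  (s ^ N)⁻¹ * (-2 * deriv profile ((s ^ 2)⁻¹ * ‖y - x‖ ^ 2))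

theorem hasDerivAt_avgKer {N : ℕ} {s : ℝ} (hs : 0 < s) (x y : EuclideanSpace ℝ (Fin N)) :
    HasDerivAt (fun s => avgKer s x y) (s * lap (potKer s x) y) s := by
  have h1 : HasDerivAt (fun s : ℝ => (s ^ N)⁻¹) (-(N * s ^ (N - 1)) / (s ^ N) ^ 2) s :=
    (hasDerivAt_pow N s).inv (by positivity)
  have h2 : HasDerivAt (fun s : ℝ => (s ^ 2)⁻¹ * ‖y - x‖ ^ 2)
      (-(2 * s) / (s ^ 2) ^ 2 * ‖y - x‖ ^ 2) s := by
    have := ((hasDerivAt_pow 2 s).inv (by positivity)).mul_const (‖y - x‖ ^ 2)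
    simpa using this
  have h3 : HasDerivAt (fun s : ℝ => -2 * deriv profile ((s ^ 2)⁻¹ * ‖y - x‖ ^ 2))
      (-2 * (deriv (deriv profile) ((s ^ 2)⁻¹ * ‖y - x‖ ^ 2)
        * (-(2 * s) / (s ^ 2) ^ 2 * ‖y - x‖ ^ 2))) s :=
    ((contDiff_deriv_profile.differentiable (by simp) _).hasDerivAt.comp s h2).const_mul _
  have h4 := h1.mul h3
  have h5 : lap (potKer s x) y = _ := lap_radial profile_contDiff ((s ^ N)⁻¹) ((s ^ 2)⁻¹) x y
  rw [h5]
  refine h4.congr_deriv ?_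
  rcases N with _ | n
  · simp; field_simp; ring
  · simp only [Nat.add_sub_cancel]; field_simp; ring

theorem potKer_nonneg {N : ℕ} {s : ℝ} (hs : 0 < s) (x y : EuclideanSpace ℝ (Fin N)) :
    0 ≤ potKer s x y := mul_nonneg (by positivity) (profile_nonneg _)

theorem potKer_le {N : ℕ} {s : ℝ} (hs : 0 < s) (x y : EuclideanSpace ℝ (Fin N)) :
    potKer s x y ≤ (s ^ N)⁻¹ :=
  mul_le_of_le_one_right (by positivity) (profile_le_one _)

theorem avgKer_nonneg {N : ℕ} {s : ℝ} (hs : 0 < s) (x y : EuclideanSpace ℝ (Fin N)) :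
    0 ≤ avgKer s x y := by
  have := deriv_profile_nonpos ((s ^ 2)⁻¹ * ‖y - x‖ ^ 2)
  exact mul_nonneg (by positivity) (by linarith)

theorem one_le_of_le_dist {N : ℕ} {s : ℝ} (hs : 0 < s) {x y : EuclideanSpace ℝ (Fin N)}
    (h : s ≤ dist y x) : 1 ≤ (s ^ 2)⁻¹ * ‖y - x‖ ^ 2 := by
  rw [← div_eq_inv_mul, le_div_iff₀ (by positivity), one_mul, ← dist_eq_norm]
  exact pow_le_pow_left₀ hs.le h 2

theorem potKer_eq_zero {N : ℕ} {s : ℝ} (hs : 0 < s) {x y : EuclideanSpace ℝ (Fin N)}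
    (h : s ≤ dist y x) : potKer s x y = 0 := by
  rw [potKer, profile_eq_zero (one_le_of_le_dist hs h), mul_zero]

theorem avgKer_eq_zero {N : ℕ} {s : ℝ} (hs : 0 < s) {x y : EuclideanSpace ℝ (Fin N)}
    (h : s ≤ dist y x) : avgKer s x y = 0 := by
  rw [avgKer, deriv_profile_eq_zero (one_le_of_le_dist hs h), mul_zero, mul_zero]

theorem potKer_contDiff {N : ℕ} (s : ℝ) (x : EuclideanSpace ℝ (Fin N)) :
    ContDiff ℝ ∞ (potKer s x) :=
  contDiff_const.mul (profile_contDiff.comp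
    (contDiff_const.mul ((contDiff_id.sub contDiff_const).norm_sq ℝ)))

theorem avgKer_contDiff {N : ℕ} (s : ℝ) (x : EuclideanSpace ℝ (Fin N)) :
    ContDiff ℝ ∞ (avgKer s x) :=
  contDiff_const.mul (contDiff_const.mul (contDiff_deriv_profile.comp
    (contDiff_const.mul ((contDiff_id.sub contDiff_const).norm_sq ℝ))))

theorem tsupport_subset_closedBall_of_eq_zero {N : ℕ} {s : ℝ} {x : EuclideanSpace ℝ (Fin N)}
    {φ : EuclideanSpace ℝ (Fin N) → ℝ}
    (h : ∀ y, s ≤ dist y x → φ y = 0) : tsupport φ ⊆ Metric.closedBall x s := by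
  refine closure_minimal (fun y hy => ?_) Metric.isClosed_closedBall
  by_contra hne
  exact hy (h y (not_le.1 hne).le)

theorem tsupport_potKer_subset {N : ℕ} {s : ℝ} (hs : 0 < s) (x : EuclideanSpace ℝ (Fin N)) :
    tsupport (potKer s x) ⊆ Metric.closedBall x s :=
  tsupport_subset_closedBall_of_eq_zero fun _ => potKer_eq_zero hs

theorem potKer_hasCompactSupport {N : ℕ} {s : ℝ} (hs : 0 < s) (x : EuclideanSpace ℝ (Fin N)) :
    HasCompactSupport (potKer s x) :=
  (isCompact_closedBall x s).of_isClosed_subset (isClosed_tsupport _) (tsupport_potKer_subset hs x)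

theorem avgKer_hasCompactSupport {N : ℕ} {s : ℝ} (hs : 0 < s) (x : EuclideanSpace ℝ (Fin N)) :
    HasCompactSupport (avgKer s x) :=
  (isCompact_closedBall x s).of_isClosed_subset (isClosed_tsupport _)
    (tsupport_subset_closedBall_of_eq_zero fun _ => avgKer_eq_zero hs)

theorem potKer_eq_rescale {N : ℕ} (s : ℝ) (x y : EuclideanSpace ℝ (Fin N)) :
    potKer s x y = (s ^ N)⁻¹ * potKer 1 0 (s⁻¹ • (y - x)) := by
  simp [potKer, norm_smul, mul_pow]

theorem avgKer_eq_rescale {N : ℕ} (s : ℝ) (x y : EuclideanSpace ℝ (Fin N)) :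
    avgKer s x y = (s ^ N)⁻¹ * avgKer 1 0 (s⁻¹ • (y - x)) := by
  simp [avgKer, norm_smul, mul_pow]

/-- Scale-invariant Hölder bounds for the two kernels, with the exponents `α = 0` and `α = 1` as
extreme cases. -/
theorem exists_kernel_bound (N : ℕ) : ∃ L : ℝ, 1 ≤ L ∧
    (∀ (s : ℝ), 0 < s → ∀ x y : EuclideanSpace ℝ (Fin N), avgKer s x y ≤ L * (s ^ N)⁻¹) ∧
    (∀ (s : ℝ), 0 < s → ∀ α : ℝ, 0 ≤ α → α ≤ 1 → ∀ x x' y : EuclideanSpace ℝ (Fin N),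
      |potKer s x y - potKer s x' y| ≤ L * (s ^ N)⁻¹ * (dist x x' / s) ^ α ∧
      |avgKer s x y - avgKer s x' y| ≤ L * (s ^ N)⁻¹ * (dist x x' / s) ^ α) := by
  obtain ⟨B, hB⟩ := (avgKer_hasCompactSupport one_pos
    (0 : EuclideanSpace ℝ (Fin N))).exists_bound_of_continuous (avgKer_contDiff 1 0).continuous
  obtain ⟨L₁, hL₁⟩ := (potKer_contDiff 1 (0 : EuclideanSpace ℝ (Fin N)))
    |>.lipschitzWith_of_hasCompactSupport
    (potKer_hasCompactSupport one_pos 0) (by simp)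
  obtain ⟨L₂, hL₂⟩ := (avgKer_contDiff 1 (0 : EuclideanSpace ℝ (Fin N)))
    |>.lipschitzWith_of_hasCompactSupport
    (avgKer_hasCompactSupport one_pos 0) (by simp)
  have hB0 : 0 ≤ B := (norm_nonneg _).trans (hB 0)
  set L : ℝ := 1 + 2 * B + L₁ + L₂ with hL
  have hL1 : 1 ≤ L := by simp only [hL]; linarith [L₁.coe_nonneg, L₂.coe_nonneg]
  have hgen : ∀ (k : EuclideanSpace ℝ (Fin N) → ℝ), (∀ a b, |k a - k b| ≤ L) →
      (∀ a b, |k a - k b| ≤ L * dist a b) → ∀ (s : ℝ), 0 < s → ∀ α : ℝ, 0 ≤ α → α ≤ 1 →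
      ∀ x x' y : EuclideanSpace ℝ (Fin N),
      |(s ^ N)⁻¹ * k (s⁻¹ • (y - x)) - (s ^ N)⁻¹ * k (s⁻¹ • (y - x'))|
        ≤ L * (s ^ N)⁻¹ * (dist x x' / s) ^ α := by
    intro k h1 h2 s hs α hα0 hα1 x x' y
    rw [← mul_sub, abs_mul, abs_of_pos (by positivity : 0 < (s ^ N)⁻¹), mul_comm L, mul_assoc]
    refine mul_le_mul_of_nonneg_left ?_ (by positivity)
    have hd : dist (s⁻¹ • (y - x)) (s⁻¹ • (y - x')) = dist x x' / s := by
      rw [dist_smul₀, dist_sub_left, Real.norm_of_nonneg (by positivity)]; ring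
    have hL0 : 0 ≤ L := by linarith
    rcases le_total (dist x x' / s) 1 with h | h
    · refine (h2 _ _).trans (mul_le_mul_of_nonneg_left ?_ hL0)
      rw [hd]
      have := Real.rpow_le_rpow_of_exponent_ge_of_imp (x := dist x x' / s) (y := 1) (z := α)
        (by positivity) h hα1 (by intro _ h1; norm_num at h1)
      simpa using this
    · exact (h1 _ _).trans (le_mul_of_one_le_right hL0 (Real.one_le_rpow h hα0))
  refine ⟨L, hL1, fun s hs x y => ?_, fun s hs α h0 h1 x x' y => ⟨?_, ?_⟩⟩
  · rw [avgKer_eq_rescale s, mul_comm]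
    refine mul_le_mul_of_nonneg_right ?_ (by positivity)
    have := (le_abs_self _).trans (hB (s⁻¹ • (y - x)))
    simp only [hL]; linarith [L₁.coe_nonneg, L₂.coe_nonneg]
  · rw [potKer_eq_rescale s, potKer_eq_rescale s]
    refine hgen _ (fun a b => ?_) (fun a b => ?_) s hs α h0 h1 x x' y
    · have e1 := potKer_nonneg one_pos 0 a
      have e2 := potKer_nonneg one_pos 0 b
      have e3 := potKer_le one_pos 0 a
      have e4 := potKer_le one_pos 0 b
      simp only [one_pow, inv_one] at e3 e4
      rw [abs_le]; constructor <;> linarith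
    · refine (hL₁.dist_le_mul a b).trans (mul_le_mul_of_nonneg_right ?_ dist_nonneg)
      simp only [hL]; linarith [L₁.coe_nonneg, L₂.coe_nonneg]
  · rw [avgKer_eq_rescale s, avgKer_eq_rescale s]
    refine hgen _ (fun a b => ?_) (fun a b => ?_) s hs α h0 h1 x x' y
    · refine (abs_sub _ _).trans ?_
      have e1 := hB a
      have e2 := hB b
      rw [Real.norm_eq_abs] at e1 e2
      simp only [hL]; linarith [L₁.coe_nonneg, L₂.coe_nonneg]
    · refine (hL₂.dist_le_mul a b).trans (mul_le_mul_of_nonneg_right ?_ dist_nonneg)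
      simp only [hL]; linarith [L₁.coe_nonneg, L₂.coe_nonneg]

/-- The total mass of the averaging kernel, the same at every scale. -/
noncomputable def kerMass (N : ℕ) : ℝ := ∫ y : EuclideanSpace ℝ (Fin N), avgKer 1 0 y

theorem integral_avgKer {N : ℕ} {s : ℝ} (hs : 0 < s) (x : EuclideanSpace ℝ (Fin N)) :
    ∫ y, avgKer s x y = kerMass N := by
  simp_rw [avgKer_eq_rescale s]
  rw [integral_const_mul, integral_sub_right_eq_self
    (fun y : EuclideanSpace ℝ (Fin N) => avgKer 1 0 (s⁻¹ • y)) x,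
    Measure.integral_comp_smul, kerMass]
  have : 0 < s ^ N := by positivity
  simp [abs_of_pos this]
  field_simp

theorem kerMass_pos {N : ℕ} (hN : 1 ≤ N) : 0 < kerMass N := by
  obtain ⟨t, ht, h⟩ := exists_deriv_profile_ne_zero
  refine (avgKer_contDiff 1 0).continuous.integral_pos_of_hasCompactSupport_nonneg_nonzero
    (x := EuclideanSpace.single ⟨0, hN⟩ (√t)) (avgKer_hasCompactSupport one_pos 0)
    (fun y => avgKer_nonneg one_pos 0 y) ?_
  simp [avgKer, Real.sq_sqrt ht.le, h]

/-! ### Smoothed averages -/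

/-- The smoothed average at scale `s` (up to the factor `kerMass N`) of `w`, extended by zero
outside `Ω`. -/
noncomputable def smoothAvg {N : ℕ} (Ω : Set (EuclideanSpace ℝ (Fin N)))
    (w : EuclideanSpace ℝ (Fin N) → ℝ) (x : EuclideanSpace ℝ (Fin N)) (s : ℝ) : ℝ :=
  ∫ y in Ω, avgKer s x y * w y

theorem integrable_continuous_compact_mul {N : ℕ} {Ω : Set (EuclideanSpace ℝ (Fin N))}
    {w φ : EuclideanSpace ℝ (Fin N) → ℝ} (hw : IntegrableOn w Ω) (hφ : Continuous φ)
    (hc : HasCompactSupport φ) : IntegrableOn (fun y => φ y * w y) Ω := by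
  obtain ⟨B, hB⟩ := hc.exists_bound_of_continuous hφ
  exact hw.bdd_mul hφ.aestronglyMeasurable (ae_of_all _ hB)

theorem hasDerivAt_smoothAvg {N : ℕ} {Ω : Set (EuclideanSpace ℝ (Fin N))}
    {w : EuclideanSpace ℝ (Fin N) → ℝ} (hw : IntegrableOn w Ω)
    (x : EuclideanSpace ℝ (Fin N)) {s : ℝ} (hs : 0 < s) :
    HasDerivAt (smoothAvg Ω w x) (s * ∫ y in Ω, lap (potKer s x) y * w y) s := by
  -- `4 t ψ''(t) + 2 N ψ'(t)` is bounded on `[0, ∞)`, being continuous and zero beyond `1`.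
  obtain ⟨B, hB⟩ : ∃ B : ℝ, ∀ t : ℝ, 0 ≤ t →
      |4 * t * deriv (deriv profile) t + 2 * N * deriv profile t| ≤ B := by
    have hc : Continuous fun t : ℝ =>
        4 * t * deriv (deriv profile) t + 2 * N * deriv profile t :=
      ((continuous_const.mul continuous_id).mul contDiff_deriv_deriv_profile.continuous).add
        (continuous_const.mul contDiff_deriv_profile.continuous)
    obtain ⟨B, hB⟩ := (isCompact_Icc (a := (0 : ℝ)) (b := 1)).exists_bound_of_continuousOn
      hc.continuousOn
    refine ⟨B, fun t ht => ?_⟩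
    rcases le_total t 1 with h | h
    · exact hB t ⟨ht, h⟩
    · rw [deriv_deriv_profile_eq_zero h, deriv_profile_eq_zero h]
      simpa using (norm_nonneg _).trans (hB 0 ⟨le_rfl, zero_le_one⟩)
  have hB0 : 0 ≤ B := (abs_nonneg _).trans (hB 0 le_rfl)
  have hbound : ∀ τ ∈ Metric.ball s (s / 2), ∀ y,
      |τ * lap (potKer τ x) y| ≤ ((s / 2) ^ (N + 1))⁻¹ * B := by
    intro τ hτ y
    rw [Metric.mem_ball, Real.dist_eq, abs_lt] at hτ
    have hτ0 : 0 < τ := by linarith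
    have h5 : lap (potKer τ x) y = _ := lap_radial profile_contDiff ((τ ^ N)⁻¹) ((τ ^ 2)⁻¹) x y
    have h6 : τ * lap (potKer τ x) y = (τ ^ (N + 1))⁻¹ *
        (4 * ((τ ^ 2)⁻¹ * ‖y - x‖ ^ 2) * deriv (deriv profile) ((τ ^ 2)⁻¹ * ‖y - x‖ ^ 2)
          + 2 * N * deriv profile ((τ ^ 2)⁻¹ * ‖y - x‖ ^ 2)) := by
      rw [h5]; field_simp; ring
    rw [h6, abs_mul, abs_of_pos (by positivity)]
    refine mul_le_mul ?_ (hB _ (by positivity)) (abs_nonneg _) (by positivity)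
    exact inv_anti₀ (by positivity) (pow_le_pow_left₀ (by positivity) (by linarith) _)
  have hmeas : ∀ᶠ τ in 𝓝 s, AEStronglyMeasurable (fun y => avgKer τ x y * w y)
      (volume.restrict Ω) := Eventually.of_forall fun τ =>
    ((avgKer_contDiff τ x).continuous.aestronglyMeasurable).mul hw.aestronglyMeasurable
  have := (hasDerivAt_integral_of_dominated_loc_of_deriv_le (μ := volume.restrict Ω)
    (F := fun τ y => avgKer τ x y * w y) (F' := fun τ y => τ * lap (potKer τ x) y * w y)
    (bound := fun y => ((s / 2) ^ (N + 1))⁻¹ * B * |w y|)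
    (Metric.ball_mem_nhds s (half_pos hs)) hmeas
    (integrable_continuous_compact_mul hw (avgKer_contDiff s x).continuous
      (avgKer_hasCompactSupport hs x))
    ((((lap_continuous (potKer_contDiff s x)).const_mul s).aestronglyMeasurable).mul
      hw.aestronglyMeasurable)
    (ae_of_all _ fun y τ hτ => by
      rw [norm_mul]
      exact mul_le_mul_of_nonneg_right (hbound τ hτ y) (norm_nonneg _))
    (hw.abs.const_mul _)
    (ae_of_all _ fun y τ hτ => by
      rw [Metric.mem_ball, Real.dist_eq, abs_lt] at hτ
      exact (hasDerivAt_avgKer (by linarith) x y).mul_const _)).2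
  refine this.congr_deriv ?_
  rw [← integral_const_mul]
  simp_rw [mul_assoc]

/-! ### Distributional form of the equation -/

/-- The Cauchy-Schwarz inequality. -/
theorem integral_mul_le_eLpNorm_two {X : Type*} [MeasurableSpace X] {μ : Measure X} {a b : X → ℝ}
    (ha : MemLp a 2 μ) (hb : MemLp b 2 μ) :
    ∫ x, |a x| * |b x| ∂μ ≤ (eLpNorm a 2 μ).toReal * (eLpNorm b 2 μ).toReal := by
  have h := real_inner_le_norm (ha.abs.toLp _) (hb.abs.toLp _)
  rw [L2.inner_def, Lp.norm_toLp, Lp.norm_toLp] at h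
  have e1 : eLpNorm |a| 2 μ = eLpNorm a 2 μ := eLpNorm_norm a
  have e2 : eLpNorm |b| 2 μ = eLpNorm b 2 μ := eLpNorm_norm b
  rw [e1, e2] at h
  refine le_of_eq_of_le (integral_congr_ae ?_) h
  filter_upwards [ha.abs.coeFn_toLp, hb.abs.coeFn_toLp] with x hx hy
  rw [hx, hy]
  simp [mul_comm]

theorem integrable_inner_of_memLp_two {X : Type*} [MeasurableSpace X] {μ : Measure X} {N : ℕ}
    {a b : X → EuclideanSpace ℝ (Fin N)} (ha : MemLp a 2 μ) (hb : MemLp b 2 μ) :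
    Integrable (fun x => inner ℝ (a x) (b x)) μ := by
  refine (L2.integrable_inner (𝕜 := ℝ) (ha.toLp a) (hb.toLp b)).congr ?_
  filter_upwards [ha.coeFn_toLp, hb.coeFn_toLp] with x hx hy
  rw [hx, hy]

theorem continuous_gradient {N : ℕ} {φ : EuclideanSpace ℝ (Fin N) → ℝ} (hφ : ContDiff ℝ ∞ φ) :
    Continuous (gradient φ) := by
  unfold gradient
  exact (LinearIsometryEquiv.continuous _).comp (hφ.continuous_fderiv (by simp))

theorem hasCompactSupport_gradient {N : ℕ} {φ : EuclideanSpace ℝ (Fin N) → ℝ}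
    (hφ : HasCompactSupport φ) : HasCompactSupport (gradient φ) := by
  unfold gradient
  exact (hφ.fderiv (𝕜 := ℝ)).comp_left (map_zero _)

theorem gradient_eq_zero_of_notMem_tsupport {N : ℕ} {φ : EuclideanSpace ℝ (Fin N) → ℝ}
    {x : EuclideanSpace ℝ (Fin N)} (hx : x ∉ tsupport φ) : gradient φ x = 0 := by
  unfold gradient
  rw [fderiv_of_notMem_tsupport (𝕜 := ℝ) hx, map_zero]

theorem inner_eq_sum_mul {N : ℕ} (a b : EuclideanSpace ℝ (Fin N)) :
    inner ℝ a b = ∑ i, a i * b i := by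
  rw [PiLp.inner_apply]
  simp [mul_comm]

/-- Green's first identity for smooth functions, one of them compactly supported. -/
theorem integral_inner_gradient_eq_neg {N : ℕ} {a φ : EuclideanSpace ℝ (Fin N) → ℝ}
    (ha : ContDiff ℝ ∞ a) (hac : HasCompactSupport a) (hφ : ContDiff ℝ ∞ φ) :
    ∫ x, inner ℝ (gradient a x) (gradient φ x) = - ∫ x, lap φ x * a x := by
  have hga : ∀ i, HasCompactSupport (fun x => gradient a x i) := fun i =>
    hac.mono' ((subset_tsupport _).trans (tsupport_gradient_apply_subset a i))
  have hi : ∀ i, Integrable (fun x => gradient a x i * gradient φ x i) := fun i =>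
    Continuous.integrable_of_hasCompactSupport
      ((gradient_contDiff_apply ha i).mul (gradient_contDiff_apply hφ i)).continuous
      (hga i).mul_right
  have hi' : ∀ i, Integrable (fun x => a x * gradient (fun y => gradient φ y i) x i) := fun i =>
    ((ha.mul (gradient_contDiff_apply (gradient_contDiff_apply hφ i)
      i)).continuous).integrable_of_hasCompactSupport hac.mul_right
  have key : ∀ i, ∫ x, gradient a x i * gradient φ x i =
      - ∫ x, a x * gradient (fun y => gradient φ y i) x i := by
    intro i
    have h := integral_mul_fderiv_eq_neg_fderiv_mul_of_integrable (μ := volume) (f := a)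
      (g := fun y => gradient φ y i) (v := EuclideanSpace.single i (1 : ℝ))
      (by simpa only [gradient_apply_eq_fderiv a] using hi i)
      (by simpa only [gradient_apply_eq_fderiv (fun y => gradient φ y i)] using hi' i)
      ((ha.mul (gradient_contDiff_apply hφ i)).continuous.integrable_of_hasCompactSupport
        hac.mul_right)
      (fun x _ => ha.differentiable (by simp) x)
      (fun x _ => (gradient_contDiff_apply hφ i).differentiable (by simp) x)
    simp only [← gradient_apply_eq_fderiv] at h
    rw [h, neg_neg]
  simp_rw [inner_eq_sum_mul]
  rw [integral_finsetSum _ fun i _ => hi i]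
  simp_rw [key]
  rw [Finset.sum_neg_distrib, ← integral_finsetSum _ fun i _ => hi' i]
  simp only [lap, Finset.mul_sum, mul_comm (∑ i, _)]

/-- A weak solution solves the equation in the sense of distributions. -/
theorem IsWeakSolution.neg_integral_lap {N : ℕ} {Ω : Set (EuclideanSpace ℝ (Fin N))}
    (hb : Bornology.IsBounded Ω) {f u : EuclideanSpace ℝ (Fin N) → ℝ} (h : IsWeakSolution Ω f u)
    {φ : EuclideanSpace ℝ (Fin N) → ℝ} (hφ : IsTestFunction Ω φ) :
    - ∫ x in Ω, lap φ x * u x = ∫ x in Ω, f x * φ x := by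
  obtain ⟨G, hG, heq⟩ := h
  have : IsFiniteMeasure (volume.restrict Ω) := ⟨by
    rw [Measure.restrict_apply_univ]; exact hb.measure_lt_top⟩
  have hu : IntegrableOn u Ω := hG.memLp.integrable one_le_two
  have hGi : ∀ i, IntegrableOn (fun x => G x i) Ω := fun i =>
    (EuclideanSpace.proj i : EuclideanSpace ℝ (Fin N) →L[ℝ] ℝ).integrable_comp
      (hG.memLp_grad.integrable one_le_two)
  have hgc : ∀ i, HasCompactSupport (fun x => gradient φ x i) := fun i =>
    hφ.hasCompactSupport.mono' ((subset_tsupport _).trans (tsupport_gradient_apply_subset φ i))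
  have hgt : ∀ i, IsTestFunction Ω (fun x => gradient φ x i) := fun i =>
    ⟨gradient_contDiff_apply hφ.smooth i, hgc i,
      (tsupport_gradient_apply_subset φ i).trans hφ.tsupport_subset⟩
  have hi : ∀ i, IntegrableOn (fun x => G x i * gradient φ x i) Ω := fun i => by
    simpa only [mul_comm] using integrable_continuous_compact_mul (hGi i)
      (gradient_contDiff_apply hφ.smooth i).continuous (hgc i)
  have hi' : ∀ i, IntegrableOn (fun x => u x * gradient (fun y => gradient φ y i) x i) Ω :=
    fun i => by
    simpa only [mul_comm] using integrable_continuous_compact_mul hu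
      (gradient_contDiff_apply (gradient_contDiff_apply hφ.smooth i) i).continuous
      ((hgc i).mono' ((subset_tsupport _).trans (tsupport_gradient_apply_subset _ i)))
  rw [← heq φ hφ]
  simp_rw [inner_eq_sum_mul]
  rw [integral_finsetSum _ fun i _ => hi i]
  have key : ∀ i, ∫ x in Ω, G x i * gradient φ x i =
      - ∫ x in Ω, u x * gradient (fun y => gradient φ y i) x i := fun i => by
    rw [hG.hasWeakGradient _ (hgt i) i, neg_neg]
  simp_rw [key]
  rw [Finset.sum_neg_distrib, ← integral_finsetSum _ fun i _ => hi' i]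
  simp only [lap, Finset.mul_sum, mul_comm (∑ i, _)]

/-! ### The absolute value of a weak solution is a subsolution across the boundary -/

/-- A smooth convex approximation of the absolute value that vanishes at `0`. -/
noncomputable def smoothAbs (δ s : ℝ) : ℝ := √(s ^ 2 + δ ^ 2) - δ

/-- The derivative of `smoothAbs δ`. -/
noncomputable def smoothSign (δ s : ℝ) : ℝ := s / √(s ^ 2 + δ ^ 2)

theorem smoothAbs_contDiff {δ : ℝ} (hδ : 0 < δ) : ContDiff ℝ ∞ (smoothAbs δ) :=
  (((contDiff_id.pow 2).add contDiff_const).sqrt fun s => by positivity).sub contDiff_const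

theorem smoothSign_contDiff {δ : ℝ} (hδ : 0 < δ) : ContDiff ℝ ∞ (smoothSign δ) :=
  contDiff_id.div (((contDiff_id.pow 2).add contDiff_const).sqrt fun s => by positivity)
    fun s => by positivity

theorem hasDerivAt_sqrt_sq_add {δ : ℝ} (hδ : 0 < δ) (s : ℝ) :
    HasDerivAt (fun s => √(s ^ 2 + δ ^ 2)) (smoothSign δ s) s := by
  have h := (((hasDerivAt_pow 2 s).add_const (δ ^ 2)).sqrt (by positivity))
  refine h.congr_deriv ?_
  rw [smoothSign]
  field_simp
  simp

theorem hasDerivAt_smoothAbs {δ : ℝ} (hδ : 0 < δ) (s : ℝ) :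
    HasDerivAt (smoothAbs δ) (smoothSign δ s) s := (hasDerivAt_sqrt_sq_add hδ s).sub_const δ

theorem hasDerivAt_smoothSign {δ : ℝ} (hδ : 0 < δ) (s : ℝ) :
    HasDerivAt (smoothSign δ) (δ ^ 2 / √(s ^ 2 + δ ^ 2) ^ 3) s := by
  have hq : √(s ^ 2 + δ ^ 2) ^ 2 = s ^ 2 + δ ^ 2 := Real.sq_sqrt (by positivity)
  have hp : 0 < √(s ^ 2 + δ ^ 2) := by positivity
  refine ((hasDerivAt_id s).div (hasDerivAt_sqrt_sq_add hδ s) hp.ne').congr_deriv ?_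
  simp only [smoothSign, id]
  field_simp
  linear_combination hq

theorem abs_smoothSign_le {δ : ℝ} (s : ℝ) : |smoothSign δ s| ≤ 1 := by
  rw [smoothSign, abs_div, abs_of_nonneg (Real.sqrt_nonneg _)]
  refine div_le_one_of_le₀ (Real.abs_le_sqrt (by nlinarith)) (Real.sqrt_nonneg _)

theorem smoothSign_deriv_nonneg (δ s : ℝ) : 0 ≤ δ ^ 2 / √(s ^ 2 + δ ^ 2) ^ 3 := by positivity

theorem smoothSign_deriv_le {δ : ℝ} (hδ : 0 < δ) (s : ℝ) :
    δ ^ 2 / √(s ^ 2 + δ ^ 2) ^ 3 ≤ 1 / δ := by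
  have hp : δ ≤ √(s ^ 2 + δ ^ 2) := Real.le_sqrt_of_sq_le (by nlinarith)
  rw [div_le_div_iff₀ (by positivity) hδ]
  have := pow_le_pow_left₀ hδ.le hp 3
  linarith [this]

theorem abs_smoothAbs_sub_abs_le {δ : ℝ} (hδ : 0 < δ) (s t : ℝ) :
    |smoothAbs δ s - (|t|)| ≤ δ + |t - s| := by
  have h1 : |s| ≤ √(s ^ 2 + δ ^ 2) := Real.abs_le_sqrt (by nlinarith)
  have h2 : √(s ^ 2 + δ ^ 2) ≤ |s| + δ := by
    rw [Real.sqrt_le_left (by positivity)]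
    nlinarith [sq_abs s, abs_nonneg s]
  have h3 := abs_abs_sub_abs_le_abs_sub t s
  rw [abs_le] at h3 ⊢
  unfold smoothAbs
  constructor <;> linarith [h3.1, h3.2]

theorem smoothAbs_zero {δ : ℝ} (hδ : 0 < δ) : smoothAbs δ 0 = 0 := by
  simp [smoothAbs, Real.sqrt_sq hδ.le]

theorem gradient_comp_apply {N : ℕ} {g : ℝ → ℝ} {g' : ℝ} {η : EuclideanSpace ℝ (Fin N) → ℝ}
    {x : EuclideanSpace ℝ (Fin N)} (hη : DifferentiableAt ℝ η x) (hg : HasDerivAt g g' (η x)) :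
    gradient (fun y => g (η y)) x = g' • gradient η x := by
  ext i
  have h : HasFDerivAt (fun y => g (η y)) _ x := hg.comp_hasFDerivAt x hη.hasFDerivAt
  rw [PiLp.smul_apply, gradient_apply_eq_fderiv, h.fderiv, gradient_apply_eq_fderiv]
  simp

theorem gradient_mul {N : ℕ} {a b : EuclideanSpace ℝ (Fin N) → ℝ}
    {x : EuclideanSpace ℝ (Fin N)} (ha : DifferentiableAt ℝ a x) (hb : DifferentiableAt ℝ b x) :
    gradient (fun y => a y * b y) x = a x • gradient b x + b x • gradient a x := by
  ext i
  have h : HasFDerivAt (fun y => a y * b y) _ x := ha.hasFDerivAt.mul hb.hasFDerivAt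
  rw [PiLp.add_apply, PiLp.smul_apply, PiLp.smul_apply, gradient_apply_eq_fderiv, h.fderiv,
    gradient_apply_eq_fderiv, gradient_apply_eq_fderiv]
  simp

/-- If `u` is a weak solution with zero boundary values then `-Δ|u| ≤ |f|` holds in the whole
space for the extension by zero. The test function needs no sign outside `Ω`. -/
theorem IsWeakSolution.neg_integral_lap_abs_le {N : ℕ} {Ω : Set (EuclideanSpace ℝ (Fin N))}
    (ho : IsOpen Ω) (hb : Bornology.IsBounded Ω) {f u : EuclideanSpace ℝ (Fin N) → ℝ}
    (h : IsWeakSolution Ω f u) (hf : IntegrableOn f Ω) {φ : EuclideanSpace ℝ (Fin N) → ℝ}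
    (hφ : ContDiff ℝ ∞ φ) (hφc : HasCompactSupport φ) (hpos : ∀ x ∈ Ω, 0 ≤ φ x) :
    - ∫ x in Ω, lap φ x * |u x| ≤ ∫ x in Ω, φ x * |f x| := by
  obtain ⟨G, hG, heq⟩ := h
  set μ := volume.restrict Ω with hμ
  have : IsFiniteMeasure μ := ⟨by
    rw [hμ, Measure.restrict_apply_univ]; exact hb.measure_lt_top⟩
  obtain ⟨S, hS⟩ := hφc.exists_bound_of_continuous hφ.continuous
  have hS0 : 0 ≤ S := (norm_nonneg _).trans (hS 0)
  have hgm : MemLp (fun x => ‖G x‖) 2 μ := hG.memLp_grad.norm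
  have hpm : MemLp (fun x => ‖gradient φ x‖) 2 μ :=
    ((continuous_gradient hφ).memLp_of_hasCompactSupport (hasCompactSupport_gradient hφc)).norm
  have hlc := lap_continuous hφ
  have hlcs := lap_hasCompactSupport hφc
  have hlm : MemLp (lap φ) 2 μ := hlc.memLp_of_hasCompactSupport hlcs
  have hli : Integrable (lap φ) μ := hlm.integrable one_le_two
  set g := (eLpNorm (fun x => ‖G x‖) 2 μ).toReal
  set p := (eLpNorm (fun x => ‖gradient φ x‖) 2 μ).toReal
  set l := (eLpNorm (lap φ) 2 μ).toReal
  set l₁ := ∫ x, |lap φ x| ∂μ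
  have hu1 : Integrable u μ := hG.memLp.integrable one_le_two
  have main : ∀ δ : ℝ, 0 < δ → - ∫ x in Ω, lap φ x * |u x| ≤ (∫ x in Ω, φ x * |f x|) +
      (S / δ * (δ ^ 2 * g + (δ ^ 2) ^ 2) + δ ^ 2 * p + (δ * l₁ + δ ^ 2 * l)) := by
    intro δ hδ
    obtain ⟨η, hη, hηu, hηG⟩ := hG.approx (ENNReal.ofReal (δ ^ 2)) (by positivity)
    have hηd := hη.smooth.differentiable (by simp)
    have hφd := hφ.differentiable (by simp)
    have hsη : ContDiff ℝ ∞ (fun y => smoothSign δ (η y)) :=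
      (smoothSign_contDiff hδ).comp hη.smooth
    set ζ : EuclideanSpace ℝ (Fin N) → ℝ := fun y => smoothSign δ (η y) * φ y with hζ
    set H : EuclideanSpace ℝ (Fin N) → EuclideanSpace ℝ (Fin N) :=
      fun x => G x - gradient η x with hH
    have hζs : ContDiff ℝ ∞ ζ := hsη.mul hφ
    have hζt : IsTestFunction Ω ζ := by
      have hsub : tsupport ζ ⊆ tsupport η := by
        refine closure_mono fun x hx hx' => hx ?_
        have : η x = 0 := hx'
        simp [hζ, this, smoothSign]
      exact ⟨hζs, hη.hasCompactSupport.of_isClosed_subset (isClosed_tsupport _) hsub,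
        hsub.trans hη.tsupport_subset⟩
    have hgζ : ∀ x, gradient ζ x = smoothSign δ (η x) • gradient φ x +
        (φ x * (δ ^ 2 / √(η x ^ 2 + δ ^ 2) ^ 3)) • gradient η x := by
      intro x
      rw [hζ, gradient_mul (hsη.differentiable (by simp) x) (hφd x),
        gradient_comp_apply (hηd x) (hasDerivAt_smoothSign hδ (η x)), smul_smul]
    have hgη := (continuous_gradient hη.smooth).memLp_of_hasCompactSupport (p := 2) (μ := μ)
      (hasCompactSupport_gradient hη.hasCompactSupport)
    have hgφ := (continuous_gradient hφ).memLp_of_hasCompactSupport (p := 2) (μ := μ)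
      (hasCompactSupport_gradient hφc)
    have hgζm := (continuous_gradient hζs).memLp_of_hasCompactSupport (p := 2) (μ := μ)
      (hasCompactSupport_gradient hζt.hasCompactSupport)
    have hHm : MemLp H 2 μ := hG.memLp_grad.sub hgη
    have hHn : MemLp (fun x => ‖H x‖) 2 μ := hHm.norm
    have hh : (eLpNorm (fun x => ‖H x‖) 2 μ).toReal ≤ δ ^ 2 := by
      rw [eLpNorm_norm]
      refine ENNReal.toReal_le_of_le_ofReal (by positivity) hηG.le
    have hd : (eLpNorm (fun x => u x - η x) 2 μ).toReal ≤ δ ^ 2 :=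
      ENNReal.toReal_le_of_le_ofReal (by positivity) hηu.le
    have hdm : MemLp (fun x => u x - η x) 2 μ := hG.memLp.sub
      (hη.smooth.continuous.memLp_of_hasCompactSupport hη.hasCompactSupport)
    -- Testing with `ζ`; below `G` is split as `H + ∇η`, and the term with `H` is an error term.
    have e1 : ∫ x, inner ℝ (G x) (gradient ζ x) ∂μ = ∫ x, f x * ζ x ∂μ := heq ζ hζt
    have e2 : ∫ x, f x * ζ x ∂μ ≤ ∫ x, φ x * |f x| ∂μ := by
      refine integral_mono_ae ?_ ?_ ?_
      · exact (integrable_continuous_compact_mul hf hζs.continuous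
          hζt.hasCompactSupport).congr (ae_of_all _ fun x => mul_comm _ _)
      · exact integrable_continuous_compact_mul hf.abs hφ.continuous hφc
      · filter_upwards [ae_restrict_mem ho.measurableSet] with x hx
        have h1 : |f x * smoothSign δ (η x)| ≤ |f x| := by
          rw [abs_mul]
          exact mul_le_of_le_one_right (abs_nonneg _) (abs_smoothSign_le _)
        calc f x * ζ x = φ x * (f x * smoothSign δ (η x)) := by simp only [hζ]; ring
          _ ≤ φ x * |f x| := mul_le_mul_of_nonneg_left ((le_abs_self _).trans h1) (hpos x hx)
    have iHζ : Integrable (fun x => inner ℝ (H x) (gradient ζ x)) μ :=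
      integrable_inner_of_memLp_two hHm hgζm
    have iηζ : Integrable (fun x => inner ℝ (gradient η x) (gradient ζ x)) μ :=
      integrable_inner_of_memLp_two hgη hgζm
    have e3 : ∫ x, inner ℝ (G x) (gradient ζ x) ∂μ =
        ∫ x, inner ℝ (H x) (gradient ζ x) ∂μ + ∫ x, inner ℝ (gradient η x) (gradient ζ x) ∂μ := by
      rw [← integral_add iHζ iηζ]
      simp only [hH, ← inner_add_left, sub_add_cancel]
    have habs : ContDiff ℝ ∞ (fun y => smoothAbs δ (η y)) := (smoothAbs_contDiff hδ).comp hη.smooth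
    have habsc : HasCompactSupport (fun y => smoothAbs δ (η y)) :=
      hη.hasCompactSupport.comp_left (smoothAbs_zero hδ)
    have hgabs : ∀ x, gradient (fun y => smoothAbs δ (η y)) x =
        smoothSign δ (η x) • gradient η x := fun x =>
      gradient_comp_apply (hηd x) (hasDerivAt_smoothAbs hδ (η x))
    have e4 : ∫ x, inner ℝ (gradient (fun y => smoothAbs δ (η y)) x) (gradient φ x) ∂μ ≤
        ∫ x, inner ℝ (gradient η x) (gradient ζ x) ∂μ := by
      refine integral_mono_ae ?_ iηζ ?_
      · exact integrable_inner_of_memLp_two ((continuous_gradient habs).memLp_of_hasCompactSupport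
          (hasCompactSupport_gradient habsc)) hgφ
      · filter_upwards [ae_restrict_mem ho.measurableSet] with x hx
        simp only [hgabs, hgζ, inner_add_right, inner_smul_left, inner_smul_right,
          real_inner_self_eq_norm_sq]
        have := mul_nonneg (mul_nonneg (hpos x hx) (smoothSign_deriv_nonneg δ (η x)))
          (sq_nonneg ‖gradient η x‖)
        simpa using this
    have hout : ∀ x, x ∉ Ω → η x = 0 := fun x hx =>
      image_eq_zero_of_notMem_tsupport fun hx' => hx (hη.tsupport_subset hx')
    have e5 : ∫ x, inner ℝ (gradient (fun y => smoothAbs δ (η y)) x) (gradient φ x) ∂μ =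
        - ∫ x, lap φ x * smoothAbs δ (η x) ∂μ := by
      have h := integral_inner_gradient_eq_neg habs habsc hφ
      rw [hμ, setIntegral_eq_integral_of_forall_compl_eq_zero, h,
        setIntegral_eq_integral_of_forall_compl_eq_zero]
      · intro x hx
        rw [hout x hx, smoothAbs_zero hδ, mul_zero]
      · intro x hx
        rw [hgabs, gradient_eq_zero_of_notMem_tsupport fun hx' => hx (hη.tsupport_subset hx')]
        simp
    have e6 : |∫ x, inner ℝ (H x) (gradient ζ x) ∂μ| ≤
        S / δ * (δ ^ 2 * g + (δ ^ 2) ^ 2) + δ ^ 2 * p := by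
      have i1 : Integrable (fun x => |‖H x‖| * |‖G x‖|) μ := (hHn.abs.integrable_mul hgm.abs)
      have i2 : Integrable (fun x => |‖H x‖| * |‖H x‖|) μ := (hHn.abs.integrable_mul hHn.abs)
      have i3 : Integrable (fun x => |‖H x‖| * |‖gradient φ x‖|) μ :=
        (hHn.abs.integrable_mul hpm.abs)
      have hpt : ∀ x, |inner ℝ (H x) (gradient ζ x)| ≤
          S / δ * (|‖H x‖| * |‖G x‖| + |‖H x‖| * |‖H x‖|) + |‖H x‖| * |‖gradient φ x‖| := by
        intro x
        simp only [abs_norm]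
        refine (abs_real_inner_le_norm _ _).trans ?_
        have h1 : ‖gradient η x‖ ≤ ‖G x‖ + ‖H x‖ := by
          have : gradient η x = G x - H x := by simp [hH]
          rw [this]; exact norm_sub_le _ _
        have h2 : |φ x * (δ ^ 2 / √(η x ^ 2 + δ ^ 2) ^ 3)| ≤ S / δ := by
          rw [abs_mul, abs_of_nonneg (smoothSign_deriv_nonneg _ _), div_eq_mul_one_div S]
          exact mul_le_mul (hS x) (smoothSign_deriv_le hδ _) (smoothSign_deriv_nonneg _ _) hS0
        have h3 : ‖gradient ζ x‖ ≤ ‖gradient φ x‖ + S / δ * (‖G x‖ + ‖H x‖) := by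
          rw [hgζ]
          refine (norm_add_le _ _).trans (add_le_add ?_ ?_)
          · rw [norm_smul]
            exact mul_le_of_le_one_left (norm_nonneg _) (abs_smoothSign_le _)
          · rw [norm_smul]
            exact mul_le_mul h2 h1 (norm_nonneg _) (by positivity)
        calc ‖H x‖ * ‖gradient ζ x‖ ≤ ‖H x‖ * (‖gradient φ x‖ + S / δ * (‖G x‖ + ‖H x‖)) :=
              mul_le_mul_of_nonneg_left h3 (norm_nonneg _)
          _ = _ := by ring
      calc |∫ x, inner ℝ (H x) (gradient ζ x) ∂μ| ≤ ∫ x, |inner ℝ (H x) (gradient ζ x)| ∂μ :=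
            abs_integral_le_integral_abs
        _ ≤ ∫ x, (S / δ * (|‖H x‖| * |‖G x‖| + |‖H x‖| * |‖H x‖|)
              + |‖H x‖| * |‖gradient φ x‖|) ∂μ :=
            integral_mono iHζ.abs (((i1.add i2).const_mul _).add i3) hpt
        _ = S / δ * (∫ x, |‖H x‖| * |‖G x‖| ∂μ + ∫ x, |‖H x‖| * |‖H x‖| ∂μ)
              + ∫ x, |‖H x‖| * |‖gradient φ x‖| ∂μ := by
            have i12 : Integrable (fun x => |‖H x‖| * |‖G x‖| + |‖H x‖| * |‖H x‖|) μ := i1.add i2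
            rw [integral_add (i12.const_mul _) i3, integral_const_mul, integral_add i1 i2]
        _ ≤ S / δ * (δ ^ 2 * g + δ ^ 2 * δ ^ 2) + δ ^ 2 * p := by
            have hg0 : 0 ≤ g := ENNReal.toReal_nonneg
            have hp0 : 0 ≤ p := ENNReal.toReal_nonneg
            refine add_le_add (mul_le_mul_of_nonneg_left (add_le_add ?_ ?_) (by positivity)) ?_
            · exact (integral_mul_le_eLpNorm_two hHn hgm).trans
                (mul_le_mul_of_nonneg_right hh hg0)
            · exact (integral_mul_le_eLpNorm_two hHn hHn).trans
                (mul_le_mul hh hh ENNReal.toReal_nonneg (by positivity))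
            · exact (integral_mul_le_eLpNorm_two hHn hpm).trans
                (mul_le_mul_of_nonneg_right hh hp0)
        _ = _ := by ring
    have iabs : Integrable (fun x => smoothAbs δ (η x)) μ :=
      (habs.continuous.integrable_of_hasCompactSupport habsc).restrict
    have e7 : |∫ x, lap φ x * smoothAbs δ (η x) ∂μ - ∫ x, lap φ x * |u x| ∂μ| ≤
        δ * l₁ + δ ^ 2 * l := by
      have i1 := integrable_continuous_compact_mul (Ω := Ω) iabs hlc hlcs
      have i2 := integrable_continuous_compact_mul (Ω := Ω) hu1.abs hlc hlcs
      have i3 : Integrable (fun x => |u x - η x| * |lap φ x|) μ := hdm.abs.integrable_mul hlm.abs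
      rw [← integral_sub i1 i2]
      calc |∫ x, (lap φ x * smoothAbs δ (η x) - lap φ x * |u x|) ∂μ|
          ≤ ∫ x, |lap φ x * smoothAbs δ (η x) - lap φ x * (|u x|)| ∂μ :=
            abs_integral_le_integral_abs
        _ ≤ ∫ x, (δ * |lap φ x| + |u x - η x| * |lap φ x|) ∂μ := by
            refine integral_mono (i1.sub i2).abs ((hli.abs.const_mul _).add i3) fun x => ?_
            simp only [← mul_sub, abs_mul]
            have := mul_le_mul_of_nonneg_left (abs_smoothAbs_sub_abs_le hδ (η x) (u x))
              (abs_nonneg (lap φ x))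
            linarith
        _ = δ * l₁ + ∫ x, |u x - η x| * |lap φ x| ∂μ := by
            rw [integral_add (hli.abs.const_mul _) i3, integral_const_mul]
        _ ≤ _ := by
            gcongr
            exact (integral_mul_le_eLpNorm_two hdm hlm).trans
              (mul_le_mul_of_nonneg_right hd ENNReal.toReal_nonneg)
    have h6 := abs_le.1 e6
    have h7 := abs_le.1 e7
    linarith [h6.1, h7.1, h7.2]
  have hlim : Tendsto (fun δ : ℝ => (∫ x in Ω, φ x * |f x|) +
      (S * (δ * g + δ ^ 3) + δ ^ 2 * p + (δ * l₁ + δ ^ 2 * l))) (𝓝[>] 0)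
      (𝓝 (∫ x in Ω, φ x * |f x|)) := by
    have : Continuous (fun δ : ℝ => (∫ x in Ω, φ x * |f x|) +
      (S * (δ * g + δ ^ 3) + δ ^ 2 * p + (δ * l₁ + δ ^ 2 * l))) := by fun_prop
    have h0 := this.tendsto 0
    simp only [zero_mul, ne_eq, OfNat.ofNat_ne_zero, not_false_eq_true, zero_pow, add_zero,
      mul_zero] at h0
    exact h0.mono_left nhdsWithin_le_nhds
  refine ge_of_tendsto hlim ?_
  filter_upwards [self_mem_nhdsWithin] with δ hδ
  have hδ : 0 < δ := hδ
  refine (main δ hδ).trans_eq ?_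
  field_simp

/-! ### Monotonicity of smoothed averages -/

/-- A weak solution on a bounded open set, with the two local quantities that control it: the
Morrey-type growth `∫_{Ω ∩ B(x,R)} |f| ≤ Λ R^(N-2+γ)` of the right-hand side at scales `R ≤ r₀`,
and the bound `A` for the mass of `|u|` in balls of radius `r₀`. -/
structure MorreyData {N : ℕ} (Ω : Set (EuclideanSpace ℝ (Fin N)))
    (u f : EuclideanSpace ℝ (Fin N) → ℝ) (r₀ γ Λ A : ℝ) : Prop where
  isOpen : IsOpen Ω
  isBounded : Bornology.IsBounded Ω
  weak : IsWeakSolution Ω f u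
  integrable_u : IntegrableOn u Ω
  integrable_f : IntegrableOn f Ω
  radius_pos : 0 < r₀
  exponent_pos : 0 < γ
  const_nonneg : 0 ≤ Λ
  morrey : ∀ x R, 0 < R → R ≤ r₀ →
    ∫ y in Ω ∩ Metric.ball x R, |f y| ≤ Λ * R ^ ((N : ℝ) - 2 + γ)
  mass : ∀ x, ∫ y in Ω ∩ Metric.ball x r₀, |u y| ≤ A

theorem abs_setIntegral_mul_le {N : ℕ} {Ω T : Set (EuclideanSpace ℝ (Fin N))}
    {w φ : EuclideanSpace ℝ (Fin N) → ℝ} {b : ℝ} (hΩ : MeasurableSet Ω) (hT : MeasurableSet T)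
    (hw : IntegrableOn w Ω) (hb : ∀ y ∈ Ω, |φ y| ≤ b) (h0 : ∀ y ∈ Ω, y ∉ T → φ y = 0) :
    |∫ y in Ω, φ y * w y| ≤ b * ∫ y in Ω ∩ T, |w y| := by
  have h1 : ∫ y in Ω, φ y * w y = ∫ y in Ω ∩ T, φ y * w y :=
    setIntegral_eq_of_subset_of_forall_sdiff_eq_zero hΩ inter_subset_left
      fun y hy => by rw [h0 y hy.1 fun h => hy.2 ⟨hy.1, h⟩, zero_mul]
  rw [h1, ← integral_const_mul, ← Real.norm_eq_abs]
  refine norm_integral_le_of_norm_le ((hw.mono_set inter_subset_left).abs.const_mul b) ?_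
  filter_upwards [ae_restrict_mem (hΩ.inter hT)] with y hy
  rw [norm_mul]
  exact mul_le_mul_of_nonneg_right (hb y hy.1) (norm_nonneg _)

/-- One-sided control of a function whose derivative is bounded below by a power. -/
theorem le_add_of_neg_rpow_le_deriv {F F' : ℝ → ℝ} {c β s t : ℝ} (hs : 0 < s) (hst : s ≤ t)
    (hβ : 0 < β) (hc : 0 ≤ c) (hF : ∀ τ ∈ Icc s t, HasDerivAt F (F' τ) τ)
    (h : ∀ τ ∈ Icc s t, -(c * τ ^ (β - 1)) ≤ F' τ) : F s ≤ F t + c / β * t ^ β := by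
  have hd : ∀ τ ∈ Icc s t, HasDerivAt (fun τ => F τ + c / β * τ ^ β)
      (F' τ + c * τ ^ (β - 1)) τ := by
    intro τ hτ
    have hτ0 : 0 < τ := hs.trans_le hτ.1
    refine ((hF τ hτ).add ((Real.hasDerivAt_rpow_const (p := β) (Or.inl hτ0.ne')).const_mul
      (c / β))).congr_deriv ?_
    field_simp
  have hm : MonotoneOn (fun τ => F τ + c / β * τ ^ β) (Icc s t) := by
    refine monotoneOn_of_deriv_nonneg (convex_Icc s t)
      (fun τ hτ => (hd τ hτ).continuousAt.continuousWithinAt)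
      (fun τ hτ => (hd τ (interior_subset hτ)).differentiableAt.differentiableWithinAt)
      (fun τ hτ => ?_)
    rw [(hd τ (interior_subset hτ)).deriv]
    linarith [h τ (interior_subset hτ)]
  have h1 := hm (left_mem_Icc.2 hst) (right_mem_Icc.2 hst) hst
  have h2 : 0 ≤ c / β * s ^ β := by positivity
  simp only at h1
  linarith

theorem scale_mul_inv_pow_mul_rpow {N : ℕ} {τ : ℝ} (hτ : 0 < τ) (γ : ℝ) :
    τ * (τ ^ N)⁻¹ * τ ^ ((N : ℝ) - 2 + γ) = τ ^ (γ - 1) := by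
  rw [← Real.rpow_natCast, ← Real.rpow_neg hτ.le]
  nth_rewrite 1 [← Real.rpow_one τ]
  rw [← Real.rpow_add hτ, ← Real.rpow_add hτ]
  congr 1; ring

variable {N : ℕ} {Ω : Set (EuclideanSpace ℝ (Fin N))} {u f : EuclideanSpace ℝ (Fin N) → ℝ}
  {r₀ γ Λ A : ℝ}

theorem integrableOn_lap_potKer_mul {w : EuclideanSpace ℝ (Fin N) → ℝ} (hw : IntegrableOn w Ω)
    {s : ℝ} (hs : 0 < s) (x : EuclideanSpace ℝ (Fin N)) :
    IntegrableOn (fun y => lap (potKer s x) y * w y) Ω :=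
  integrable_continuous_compact_mul hw (lap_continuous (potKer_contDiff s x))
    (lap_hasCompactSupport (potKer_hasCompactSupport hs x))

theorem hasDerivAt_smoothAvg_sub {w : EuclideanSpace ℝ (Fin N) → ℝ} (hw : IntegrableOn w Ω)
    (c : ℝ) (x x' : EuclideanSpace ℝ (Fin N)) {s : ℝ} (hs : 0 < s) :
    HasDerivAt (fun s => smoothAvg Ω w x s - c * smoothAvg Ω w x' s)
      (s * ∫ y in Ω, lap (fun y => potKer s x y - c * potKer s x' y) y * w y) s := by
  refine ((hasDerivAt_smoothAvg hw x hs).sub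
    ((hasDerivAt_smoothAvg hw x' hs).const_mul c)).congr_deriv ?_
  have h : ∀ y, lap (fun y => potKer s x y - c * potKer s x' y) y * w y =
      lap (potKer s x) y * w y - c * (lap (potKer s x') y * w y) := fun y => by
    rw [lap_sub_mul c (potKer_contDiff s x) (potKer_contDiff s x')]; ring
  simp_rw [h]
  rw [integral_sub (integrableOn_lap_potKer_mul hw hs x)
    ((integrableOn_lap_potKer_mul hw hs x').const_mul c), integral_const_mul]
  ring

theorem potKer_sub_contDiff (c s : ℝ) (x x' : EuclideanSpace ℝ (Fin N)) :
    ContDiff ℝ ∞ (fun y => potKer s x y - c * potKer s x' y) :=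
  (potKer_contDiff s x).sub (contDiff_const.mul (potKer_contDiff s x'))

theorem potKer_sub_hasCompactSupport (c : ℝ) {s : ℝ} (hs : 0 < s)
    (x x' : EuclideanSpace ℝ (Fin N)) :
    HasCompactSupport (fun y => potKer s x y - c * potKer s x' y) :=
  (potKer_hasCompactSupport hs x).sub ((potKer_hasCompactSupport hs x').mul_left)

/-- Almost monotonicity in the scale of the smoothed average of `|u|` at `x`, corrected by the
average at a second point `x'` whose potential kernel, weighted by `c`, is dominated on `Ω` by
the one at `x`. With `c = 0` this is the mean value inequality for subsolutions; with `c = 1` and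
`x'` the mirror image of `x` it is the same inequality for a half-space. -/
theorem MorreyData.smoothAvg_sub_le (D : MorreyData Ω u f r₀ γ Λ A) {c : ℝ} (hc : 0 ≤ c)
    {x x' : EuclideanSpace ℝ (Fin N)} {s t : ℝ} (hs : 0 < s) (hst : s ≤ t) (ht : t ≤ r₀)
    (hdom : ∀ τ, 0 < τ → τ ≤ t → ∀ y ∈ Ω, c * potKer τ x' y ≤ potKer τ x y) :
    smoothAvg Ω (fun y => |u y|) x s - c * smoothAvg Ω (fun y => |u y|) x' s ≤
      smoothAvg Ω (fun y => |u y|) x t - c * smoothAvg Ω (fun y => |u y|) x' t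
        + Λ / γ * t ^ γ := by
  refine le_add_of_neg_rpow_le_deriv
    (F := fun s => smoothAvg Ω (fun y => |u y|) x s - c * smoothAvg Ω (fun y => |u y|) x' s)
    hs hst D.exponent_pos D.const_nonneg
    (fun τ hτ => hasDerivAt_smoothAvg_sub D.integrable_u.abs c x x' (hs.trans_le hτ.1))
    fun τ hτ => ?_
  have hτ0 : 0 < τ := hs.trans_le hτ.1
  have hφ : ∀ y ∈ Ω, 0 ≤ potKer τ x y - c * potKer τ x' y := fun y hy =>
    sub_nonneg.2 (hdom τ hτ0 hτ.2 y hy)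
  have hφ' : ∀ y, potKer τ x y - c * potKer τ x' y ≤ potKer τ x y := fun y =>
    sub_le_self _ (mul_nonneg hc (potKer_nonneg hτ0 x' y))
  have h1 := D.weak.neg_integral_lap_abs_le D.isOpen D.isBounded D.integrable_f
    (potKer_sub_contDiff c τ x x') (potKer_sub_hasCompactSupport c hτ0 x x') hφ
  have h2 := abs_setIntegral_mul_le (φ := fun y => potKer τ x y - c * potKer τ x' y)
    (b := (τ ^ N)⁻¹) D.isOpen.measurableSet
    (Metric.isOpen_ball (x := x) (ε := τ)).measurableSet D.integrable_f.abs
    (fun y hy => by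
      rw [abs_of_nonneg (hφ y hy)]
      exact (hφ' y).trans (potKer_le hτ0 x y))
    (fun y hy hy' => by
      rw [Metric.mem_ball, not_lt] at hy'
      have := hφ' y
      rw [potKer_eq_zero hτ0 hy'] at this
      exact le_antisymm (by rwa [potKer_eq_zero hτ0 hy']) (hφ y hy))
  simp only [abs_abs] at h2
  have h3 := (le_abs_self _).trans h2
  have h4 := D.morrey x τ hτ0 (hτ.2.trans ht)
  have h5 : ∫ y in Ω, (potKer τ x y - c * potKer τ x' y) * |f y| ≤
      (τ ^ N)⁻¹ * (Λ * τ ^ ((N : ℝ) - 2 + γ)) :=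
    h3.trans (mul_le_mul_of_nonneg_left h4 (by positivity))
  have h6 : τ * ((τ ^ N)⁻¹ * (Λ * τ ^ ((N : ℝ) - 2 + γ))) = Λ * τ ^ (γ - 1) := by
    rw [← scale_mul_inv_pow_mul_rpow hτ0 (N := N)]; ring
  have h7 := mul_le_mul_of_nonneg_left (h1.trans h5) hτ0.le
  rw [h6] at h7
  linarith

theorem setIntegral_union_abs_le {w : EuclideanSpace ℝ (Fin N) → ℝ}
    {S T : Set (EuclideanSpace ℝ (Fin N))} (hw : IntegrableOn w Ω) :
    ∫ y in Ω ∩ (S ∪ T), |w y| ≤ (∫ y in Ω ∩ S, |w y|) + ∫ y in Ω ∩ T, |w y| := by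
  have hS : IntegrableOn (fun y => |w y|) (Ω ∩ S) := (hw.mono_set inter_subset_left).abs
  have hT : IntegrableOn (fun y => |w y|) (Ω ∩ T) := (hw.mono_set inter_subset_left).abs
  rw [inter_union_distrib_left, ← integral_add_measure hS hT]
  exact integral_mono_measure (Measure.restrict_union_le _ _)
    (ae_of_all _ fun _ => abs_nonneg _) (Integrable.add_measure hS hT)

/-- Comparison in the scale of the difference of the smoothed averages of `u` at two interior
points. -/
theorem MorreyData.abs_smoothAvg_sub_le (D : MorreyData Ω u f r₀ γ Λ A) {L : ℝ} (hL0 : 0 ≤ L)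
    (hL : ∀ (s : ℝ), 0 < s → ∀ α : ℝ, 0 ≤ α → α ≤ 1 → ∀ x x' y : EuclideanSpace ℝ (Fin N),
      |potKer s x y - potKer s x' y| ≤ L * (s ^ N)⁻¹ * (dist x x' / s) ^ α)
    {α : ℝ} (h0 : 0 ≤ α) (h1 : α ≤ 1) (hα : α < γ)
    {x x' : EuclideanSpace ℝ (Fin N)} {s t : ℝ} (hs : 0 < s) (hst : s ≤ t) (ht : t ≤ r₀)
    (hx : Metric.closedBall x t ⊆ Ω) (hx' : Metric.closedBall x' t ⊆ Ω) :
    |smoothAvg Ω u x s - smoothAvg Ω u x' s| ≤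
      |smoothAvg Ω u x t - smoothAvg Ω u x' t|
        + 2 * L * Λ * dist x x' ^ α / (γ - α) * t ^ (γ - α) := by
  set F' : ℝ → ℝ := fun τ =>
    τ * ∫ y in Ω, lap (fun y => potKer τ x y - 1 * potKer τ x' y) y * u y with hF'
  have hd : ∀ τ ∈ Icc s t, HasDerivAt (fun s => smoothAvg Ω u x s - smoothAvg Ω u x' s)
      (F' τ) τ := fun τ hτ => by
    simpa only [one_mul, hF'] using
      hasDerivAt_smoothAvg_sub D.integrable_u 1 x x' (hs.trans_le hτ.1)
  have hΛ := D.const_nonneg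
  have hbound : ∀ τ ∈ Icc s t, |F' τ| ≤ 2 * L * Λ * dist x x' ^ α * τ ^ (γ - α - 1) := by
    intro τ hτ
    have hτ0 : 0 < τ := hs.trans_le hτ.1
    have htest : IsTestFunction Ω (fun y => potKer τ x y - 1 * potKer τ x' y) := by
      refine ⟨potKer_sub_contDiff 1 τ x x', potKer_sub_hasCompactSupport 1 hτ0 x x', ?_⟩
      refine (tsupport_sub _ _).trans (union_subset ?_ ?_)
      · exact (tsupport_potKer_subset hτ0 x).trans
          ((Metric.closedBall_subset_closedBall hτ.2).trans hx)
      · refine Subset.trans ?_ ((tsupport_potKer_subset hτ0 x').trans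
          ((Metric.closedBall_subset_closedBall hτ.2).trans hx'))
        simp only [one_mul]; exact Subset.rfl
    have e1 := D.weak.neg_integral_lap D.isBounded htest
    have e2 := abs_setIntegral_mul_le (φ := fun y => potKer τ x y - 1 * potKer τ x' y)
      (T := Metric.ball x τ ∪ Metric.ball x' τ) (b := L * (τ ^ N)⁻¹ * (dist x x' / τ) ^ α)
      D.isOpen.measurableSet
      (Metric.isOpen_ball.union Metric.isOpen_ball).measurableSet D.integrable_f
      (fun y _ => by simpa only [one_mul] using hL τ hτ0 α h0 h1 x x' y)
      (fun y _ hy' => by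
        simp only [mem_union, Metric.mem_ball, not_or, not_lt] at hy'
        rw [potKer_eq_zero hτ0 hy'.1, potKer_eq_zero hτ0 hy'.2]; simp)
    have e3 : ∫ y in Ω ∩ (Metric.ball x τ ∪ Metric.ball x' τ), |f y| ≤
        2 * (Λ * τ ^ ((N : ℝ) - 2 + γ)) := by
      refine (setIntegral_union_abs_le D.integrable_f).trans ?_
      linarith [D.morrey x τ hτ0 (hτ.2.trans ht), D.morrey x' τ hτ0 (hτ.2.trans ht)]
    have e4 : |∫ y in Ω, lap (fun y => potKer τ x y - 1 * potKer τ x' y) y * u y| ≤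
        L * (τ ^ N)⁻¹ * (dist x x' / τ) ^ α * (2 * (Λ * τ ^ ((N : ℝ) - 2 + γ))) := by
      rw [← abs_neg, e1]
      simp_rw [mul_comm (f _)]
      exact e2.trans (mul_le_mul_of_nonneg_left e3 (by positivity))
    have e5 : τ ^ (γ - α - 1) = τ ^ (γ - 1) / τ ^ α := by
      rw [← Real.rpow_sub hτ0]; congr 1; ring
    rw [hF', abs_mul, abs_of_pos hτ0]
    refine (mul_le_mul_of_nonneg_left e4 hτ0.le).trans_eq ?_
    rw [e5, ← scale_mul_inv_pow_mul_rpow hτ0 (N := N), Real.div_rpow dist_nonneg hτ0.le]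
    ring
  have hpow : 0 ≤ 2 * L * Λ * dist x x' ^ α := by positivity
  have up := le_add_of_neg_rpow_le_deriv hs hst (sub_pos.2 hα) hpow hd
    fun τ hτ => (abs_le.1 (hbound τ hτ)).1
  have dn := le_add_of_neg_rpow_le_deriv hs hst (sub_pos.2 hα) hpow
    (fun τ hτ => (hd τ hτ).neg) fun τ hτ => by linarith [(abs_le.1 (hbound τ hτ)).2]
  simp only [Pi.neg_apply] at up dn
  rw [abs_le]
  constructor
  · linarith [neg_abs_le (smoothAvg Ω u x t - smoothAvg Ω u x' t)]
  · linarith [le_abs_self (smoothAvg Ω u x t - smoothAvg Ω u x' t)]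

theorem abs_smoothAvg_le {s : ℝ} (hs : 0 < s) (x : EuclideanSpace ℝ (Fin N)) :
    |smoothAvg Ω u x s| ≤ smoothAvg Ω (fun y => |u y|) x s := by
  refine abs_integral_le_integral_abs.trans_eq ?_
  simp only [abs_mul, abs_of_nonneg (avgKer_nonneg hs x _), smoothAvg]

/-- The mean value inequality: smoothed averages of `|u|` are bounded by the mass of `|u|` at
the largest scale. -/
theorem MorreyData.smoothAvg_abs_le (D : MorreyData Ω u f r₀ γ Λ A) {L : ℝ}
    (hL : ∀ (s : ℝ), 0 < s → ∀ x y : EuclideanSpace ℝ (Fin N), avgKer s x y ≤ L * (s ^ N)⁻¹)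
    (hL0 : 0 ≤ L) {s : ℝ} (hs : 0 < s) (hsr : s ≤ r₀) (x : EuclideanSpace ℝ (Fin N)) :
    smoothAvg Ω (fun y => |u y|) x s ≤ L * (r₀ ^ N)⁻¹ * A + Λ / γ * r₀ ^ γ := by
  have h := D.smoothAvg_sub_le (c := 0) le_rfl (x := x) (x' := x) hs hsr le_rfl
    (fun τ hτ _ y _ => by rw [zero_mul]; exact potKer_nonneg hτ x y)
  simp only [zero_mul, sub_zero] at h
  refine h.trans (add_le_add_left ?_ _)
  have hr := D.radius_pos
  have h2 := abs_setIntegral_mul_le (φ := avgKer r₀ x) (b := L * (r₀ ^ N)⁻¹)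
    D.isOpen.measurableSet (Metric.isOpen_ball (x := x) (ε := r₀)).measurableSet
    D.integrable_u.abs
    (fun y _ => by rw [abs_of_nonneg (avgKer_nonneg hr x y)]; exact hL r₀ hr x y)
    (fun y _ hy => by rw [Metric.mem_ball, not_lt] at hy; exact avgKer_eq_zero hr hy)
  simp only [abs_abs] at h2
  exact (le_abs_self _).trans (h2.trans (mul_le_mul_of_nonneg_left (D.mass x) (by positivity)))

/-! ### The precise representative -/

/-- At almost every point of `Ω` the smoothed averages converge to the value of the function. -/
theorem ae_tendsto_smoothAvg (hΩ : MeasurableSet Ω) (hu : IntegrableOn u Ω) :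
    ∀ᵐ x ∂volume.restrict Ω,
      Tendsto (smoothAvg Ω u x) (𝓝[>] 0) (𝓝 (kerMass N * u x)) := by
  set U : EuclideanSpace ℝ (Fin N) → ℝ := Ω.indicator u with hU
  have hUi : Integrable U := hu.integrable_indicator hΩ
  obtain ⟨L, -, hL, -⟩ := exists_kernel_bound N
  have hae := (Besicovitch.vitaliFamily
    (volume : Measure (EuclideanSpace ℝ (Fin N)))).ae_tendsto_average_norm_sub
    hUi.locallyIntegrable
  filter_upwards [ae_restrict_of_ae hae, ae_restrict_mem hΩ] with x hx hxΩ
  have hx' := hx.comp (Besicovitch.tendsto_filterAt volume x)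
  set κ := volume.real (Metric.closedBall (0 : EuclideanSpace ℝ (Fin N)) 1) with hκ
  have hlim := hx'.const_mul (L * κ)
  rw [mul_zero] at hlim
  rw [tendsto_iff_norm_sub_tendsto_zero]
  refine squeeze_zero' (Eventually.of_forall fun s => norm_nonneg _) ?_ hlim
  filter_upwards [self_mem_nhdsWithin] with s hs
  have hs : 0 < s := hs
  have e1 : smoothAvg Ω u x s = ∫ y, avgKer s x y * U y := by
    rw [smoothAvg, ← integral_indicator hΩ]
    refine integral_congr_ae (ae_of_all _ fun y => ?_)
    simp only [hU, indicator]
    split_ifs <;> simp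
  have iK : Integrable (avgKer s x) :=
    (avgKer_contDiff s x).continuous.integrable_of_hasCompactSupport
      (avgKer_hasCompactSupport hs x)
  have iKU : Integrable (fun y => avgKer s x y * U y) := by
    have := integrable_continuous_compact_mul (Ω := univ) hUi.integrableOn
      (avgKer_contDiff s x).continuous (avgKer_hasCompactSupport hs x)
    rwa [integrableOn_univ] at this
  have iD : IntegrableOn (fun y => U y - U x) (Metric.closedBall x s) :=
    hUi.integrableOn.sub (integrableOn_const measure_closedBall_lt_top.ne)
  have e2 : kerMass N * u x = ∫ y, avgKer s x y * U x := by
    rw [integral_mul_const, integral_avgKer hs, hU, indicator_of_mem hxΩ]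
  have e3 : ∀ y, avgKer s x y * U y - avgKer s x y * U x =
      (Metric.closedBall x s).indicator (fun y => avgKer s x y * (U y - U x)) y := by
    intro y
    by_cases hy : y ∈ Metric.closedBall x s
    · rw [indicator_of_mem hy]; ring
    · rw [indicator_of_notMem hy, avgKer_eq_zero hs (not_le.1 hy).le]; ring
  have hv : volume.real (Metric.closedBall x s) = s ^ N * κ := by
    rw [measureReal_def, Measure.addHaar_closedBall volume x hs.le, ENNReal.toReal_mul, hκ,
      measureReal_def, Measure.addHaar_closedBall volume 0 zero_le_one]
    rw [ENNReal.toReal_ofReal (by positivity)]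
    simp
  rw [e1, e2, ← integral_sub iKU (iK.mul_const _)]
  simp_rw [e3]
  rw [integral_indicator Metric.isClosed_closedBall.measurableSet]
  have e4 : ‖∫ y in Metric.closedBall x s, avgKer s x y * (U y - U x)‖ ≤
      ∫ y in Metric.closedBall x s, L * (s ^ N)⁻¹ * ‖U y - U x‖ := by
    refine norm_integral_le_of_norm_le (iD.norm.const_mul _) (ae_of_all _ fun y => ?_)
    rw [norm_mul, Real.norm_of_nonneg (avgKer_nonneg hs x y)]
    exact mul_le_mul_of_nonneg_right (hL s hs x y) (norm_nonneg _)
  refine e4.trans_eq ?_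
  rw [integral_const_mul, Function.comp_apply, setAverage_eq, hv]
  have : κ ≠ 0 := by
    rw [hκ]
    exact (ENNReal.toReal_pos (Metric.measure_closedBall_pos volume _ one_pos).ne'
      measure_closedBall_lt_top.ne).ne'
  simp
  field_simp

/-- `v` is a precise representative of `u`: it agrees with `u` almost everywhere in `Ω`, and
its value at each point is the limit, along a fixed nonprincipal ultrafilter, of the normalized
smoothed averages of `u` at the scales `1 / (n + 1)`. The ultrafilter makes bounded averages
converge at every point. -/
structure IsPreciseRep (Ω : Set (EuclideanSpace ℝ (Fin N)))
    (u v : EuclideanSpace ℝ (Fin N) → ℝ) : Prop where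
  ae_eq : v =ᵐ[volume.restrict Ω] u
  tendsto : ∀ x, Tendsto (fun n : ℕ => smoothAvg Ω u x (1 / ((n : ℝ) + 1)))
    (hyperfilter ℕ) (𝓝 (kerMass N * v x))

theorem tendsto_scale : Tendsto (fun n : ℕ => 1 / ((n : ℝ) + 1)) (hyperfilter ℕ) (𝓝[>] 0) := by
  refine Tendsto.mono_left ?_ Nat.hyperfilter_le_atTop
  rw [tendsto_nhdsWithin_iff]
  exact ⟨tendsto_one_div_add_atTop_nhds_zero_nat, Eventually.of_forall fun n => by
    simp only [mem_Ioi]; positivity⟩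

theorem MorreyData.exists_isPreciseRep (hN : 1 ≤ N) (D : MorreyData Ω u f r₀ γ Λ A) :
    ∃ v, IsPreciseRep Ω u v := by
  obtain ⟨L, hL1, hL, -⟩ := exists_kernel_bound N
  set B := L * (r₀ ^ N)⁻¹ * A + Λ / γ * r₀ ^ γ
  have hm := kerMass_pos hN
  have hex : ∀ x, ∃ l, Tendsto (fun n : ℕ => smoothAvg Ω u x (1 / ((n : ℝ) + 1)))
      (hyperfilter ℕ) (𝓝 (kerMass N * l)) := by
    intro x
    have hev : ∀ᶠ n : ℕ in (hyperfilter ℕ : Filter ℕ),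
        smoothAvg Ω u x (1 / ((n : ℝ) + 1)) ∈ Icc (-B) B := by
      have h1 : ∀ᶠ s in 𝓝[>] (0 : ℝ), smoothAvg Ω u x s ∈ Icc (-B) B := by
        filter_upwards [Ioc_mem_nhdsGT D.radius_pos] with s hs
        exact abs_le.1 ((abs_smoothAvg_le hs.1 x).trans
          (D.smoothAvg_abs_le hL (by linarith) hs.1 hs.2 x))
      exact tendsto_scale.eventually h1
    obtain ⟨l, -, hl⟩ := isCompact_Icc.ultrafilter_le_nhds
      ((hyperfilter ℕ).map fun n : ℕ => smoothAvg Ω u x (1 / ((n : ℝ) + 1)))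
      (le_principal_iff.2 hev)
    refine ⟨l / kerMass N, ?_⟩
    rw [mul_div_cancel₀ _ hm.ne']
    exact hl
  choose v hv using hex
  refine ⟨v, ?_, hv⟩
  filter_upwards [ae_tendsto_smoothAvg D.isOpen.measurableSet D.integrable_u] with x hx
  have := tendsto_nhds_unique (hv x) (hx.comp tendsto_scale)
  exact mul_left_cancel₀ hm.ne' this

theorem IsPreciseRep.abs_le (hN : 1 ≤ N) {v : EuclideanSpace ℝ (Fin N) → ℝ}
    (hv : IsPreciseRep Ω u v) {x : EuclideanSpace ℝ (Fin N)} {b : ℝ}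
    (h : ∀ᶠ s in 𝓝[>] (0 : ℝ), |smoothAvg Ω u x s| ≤ b) : |v x| ≤ b / kerMass N := by
  have hm := kerMass_pos hN
  have h1 := le_of_tendsto (hv.tendsto x).abs (tendsto_scale.eventually h)
  rw [abs_mul, abs_of_pos hm] at h1
  rwa [le_div_iff₀ hm, mul_comm]

theorem IsPreciseRep.abs_sub_le (hN : 1 ≤ N) {v : EuclideanSpace ℝ (Fin N) → ℝ}
    (hv : IsPreciseRep Ω u v) {x x' : EuclideanSpace ℝ (Fin N)} {b : ℝ}
    (h : ∀ᶠ s in 𝓝[>] (0 : ℝ), |smoothAvg Ω u x s - smoothAvg Ω u x' s| ≤ b) :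
    |v x - v x'| ≤ b / kerMass N := by
  have hm := kerMass_pos hN
  have h1 := le_of_tendsto ((hv.tendsto x).sub (hv.tendsto x')).abs (tendsto_scale.eventually h)
  rw [← mul_sub, abs_mul, abs_of_pos hm] at h1
  rwa [le_div_iff₀ hm, mul_comm]

/-! ### One-sided flatness at all scales -/

/-- A connected set that meets `Ω` but not its frontier lies in `Ω`. -/
theorem subset_of_isPreconnected_of_disjoint_frontier {X : Type*} [TopologicalSpace X]
    {S T : Set X} (hS : IsPreconnected S) (hT : IsOpen T) (hd : ∀ y ∈ S, y ∉ frontier T)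
    {y : X} (hyS : y ∈ S) (hyT : y ∈ T) : S ⊆ T := by
  refine hS.subset_left_of_subset_union hT isClosed_closure.isOpen_compl
    (disjoint_compl_right.mono_left subset_closure) (fun z hz => ?_) ⟨y, hyS, hyT⟩
  by_cases h : z ∈ closure T
  · left
    have := hd z hz
    rw [hT.frontier_eq] at this
    by_contra hzT
    exact this ⟨h, hzT⟩
  · exact Or.inr h

/-- The two consequences of `ε`-flatness at scale `r`: boundary points are close to the
hyperplane, and points of the hyperplane are close to the boundary. -/
theorem flat_consequences {ε r : ℝ} (hε : 0 < ε) (hr : 0 < r) {S : Set (EuclideanSpace ℝ (Fin N))}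
    {x ν : EuclideanSpace ℝ (Fin N)} (hx : x ∈ S) (hν : ‖ν‖ = 1)
    (h : 1 / r * Metric.hausdorffDist (S ∩ Metric.ball x r)
      (hyperplane x ν ∩ Metric.ball x r) ≤ ε) :
    (∀ y ∈ S ∩ Metric.ball x r, |inner ℝ ν (y - x)| ≤ ε * r) ∧
    ∀ p ∈ hyperplane x ν ∩ Metric.ball x r, ∃ y ∈ S ∩ Metric.ball x r, dist y p < 2 * ε * r := by
  have hd : Metric.hausdorffDist (S ∩ Metric.ball x r) (hyperplane x ν ∩ Metric.ball x r)
      ≤ ε * r := by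
    rw [one_div, inv_mul_le_iff₀ hr] at h; linarith
  have hxb : x ∈ Metric.ball x r := Metric.mem_ball_self hr
  have hxP : x ∈ hyperplane x ν ∩ Metric.ball x r := ⟨by simp [hyperplane], hxb⟩
  have hfin : Metric.hausdorffEDist (S ∩ Metric.ball x r)
      (hyperplane x ν ∩ Metric.ball x r) ≠ ⊤ :=
    Metric.hausdorffEDist_ne_top_of_nonempty_of_bounded ⟨x, hx, hxb⟩ ⟨x, hxP⟩
      (Metric.isBounded_ball.subset inter_subset_right)
      (Metric.isBounded_ball.subset inter_subset_right)
  refine ⟨fun y hy => ?_, fun p hp => ?_⟩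
  · have h1 := (Metric.infDist_le_hausdorffDist_of_mem hy hfin).trans hd
    refine le_trans ?_ h1
    refine (Metric.le_infDist ⟨x, hxP⟩).2 fun p hp => ?_
    have h2 : inner ℝ ν (p - x) = 0 := hp.1
    have h3 : inner ℝ ν (y - x) = inner ℝ ν (y - p) := by
      rw [← sub_zero (inner ℝ ν (y - x)), ← h2, ← inner_sub_right]; congr 1; abel
    rw [h3, dist_eq_norm]
    simpa [hν] using abs_real_inner_le_norm ν (y - p)
  · have : Metric.hausdorffDist (S ∩ Metric.ball x r)
        (hyperplane x ν ∩ Metric.ball x r) < 2 * ε * r := by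
      have : 0 < ε * r := by positivity
      linarith
    exact Metric.exists_dist_lt_of_hausdorffDist_lt' hp this hfin

/-- Passage to a smaller scale: if `Ω` lies on one side of a hyperplane at scale `r`, up to an
error `2εr`, then it does so at scale `θr`, for the hyperplane given by flatness at that scale.
The two hyperplanes are almost parallel, so the cap at the smaller scale meets the complement of
`Ω`; being convex and free of boundary points, it lies in that complement. -/
theorem one_sided_step {ε θ r : ℝ} (hε : 0 < ε) (hθ : 0 < θ) (hθ1 : θ < 1) (hεθ : ε ≤ θ / 8)
    (hr : 0 < r) (hΩ : IsOpen Ω) {x ν ν' : EuclideanSpace ℝ (Fin N)} (hx : x ∈ frontier Ω)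
    (hν : ‖ν‖ = 1) (hν' : ‖ν'‖ = 1)
    (hnear : ∀ y ∈ frontier Ω ∩ Metric.ball x r, |inner ℝ ν (y - x)| ≤ ε * r)
    (hside : ∀ y ∈ Ω ∩ Metric.ball x r, -(2 * ε * r) < inner ℝ ν (y - x))
    (hflat : 1 / (θ * r) * Metric.hausdorffDist (frontier Ω ∩ Metric.ball x (θ * r))
      (hyperplane x ν' ∩ Metric.ball x (θ * r)) ≤ ε) :
    ∃ σ, (σ = ν' ∨ σ = -ν') ∧
      ∀ y ∈ Ω ∩ Metric.ball x (θ * r), -(2 * ε * (θ * r)) < inner ℝ σ (y - x) := by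
  have hρ : 0 < θ * r := by positivity
  have hsub : Metric.ball x (θ * r) ⊆ Metric.ball x r :=
    Metric.ball_subset_ball (by nlinarith)
  obtain ⟨near', close'⟩ := flat_consequences hε hρ hx hν' hflat
  -- `e` is the component of `ν` along the new hyperplane.
  set a : ℝ := inner ℝ ν' ν with ha
  set e := ν - a • ν' with he
  have hνν : inner ℝ ν ν = (1 : ℝ) := by rw [real_inner_self_eq_norm_sq, hν]; norm_num
  have hνν' : inner ℝ ν' ν' = (1 : ℝ) := by rw [real_inner_self_eq_norm_sq, hν']; norm_num
  have h1 : inner ℝ ν' e = 0 := by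
    rw [he, inner_sub_right, inner_smul_right, hνν', ← ha]; ring
  have h2 : inner ℝ ν e = 1 - a ^ 2 := by
    rw [he, inner_sub_right, inner_smul_right, hνν, real_inner_comm, ← ha]; ring
  have h3 : ‖e‖ ^ 2 = 1 - a ^ 2 := by
    rw [← real_inner_self_eq_norm_sq]
    nth_rewrite 1 [he]
    rw [inner_sub_left, inner_smul_left, h1, h2]; simp
  have hen : ‖e‖ ≤ 1 := by
    have : ‖e‖ ^ 2 ≤ 1 := by rw [h3]; nlinarith [sq_nonneg a]
    nlinarith [norm_nonneg e]
  have ha4 : 1 / 4 ≤ a ^ 2 := by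
    have hp : x + (θ * r / 2) • e ∈ hyperplane x ν' ∩ Metric.ball x (θ * r) := by
      constructor
      · simp [hyperplane, inner_smul_right, h1]
      · rw [Metric.mem_ball, dist_eq_norm, add_sub_cancel_left, norm_smul,
          Real.norm_of_nonneg (by positivity)]
        nlinarith [norm_nonneg e]
    obtain ⟨y, hy, hyp⟩ := close' _ hp
    have h4 := (abs_le.1 (hnear y ⟨hy.1, hsub hy.2⟩)).2
    have h5 : inner ℝ ν (x + (θ * r / 2) • e - y) ≤ 2 * ε * (θ * r) := by
      refine (le_abs_self _).trans ((abs_real_inner_le_norm _ _).trans ?_)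
      rw [hν, one_mul, ← dist_eq_norm, dist_comm]
      exact hyp.le
    have h6 : inner ℝ ν (x + (θ * r / 2) • e - y) + inner ℝ ν (y - x) =
        θ * r / 2 * (1 - a ^ 2) := by
      rw [← inner_add_right, ← h2, ← inner_smul_right]; congr 1; abel
    have h7 : θ * r / 2 * (1 - a ^ 2) ≤ 3 * ε * r := by
      have : ε * (θ * r) ≤ ε * r := mul_le_mul_of_nonneg_left (by nlinarith) hε.le
      linarith
    have h8 : θ / 2 * (1 - a ^ 2) ≤ 3 * ε := by
      have : (θ / 2 * (1 - a ^ 2)) * r ≤ (3 * ε) * r := by linarith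
      exact le_of_mul_le_mul_right this hr
    nlinarith
  -- The sign of the new normal is chosen so that both normals point to the same side.
  obtain ⟨σ, hσ, hσa⟩ : ∃ σ, (σ = ν' ∨ σ = -ν') ∧ 1 / 2 ≤ inner ℝ σ ν := by
    rcases le_total 0 a with h | h
    · exact ⟨ν', Or.inl rfl, by nlinarith⟩
    · exact ⟨-ν', Or.inr rfl, by rw [inner_neg_left, ← ha]; nlinarith⟩
  refine ⟨σ, hσ, ?_⟩
  have nearσ : ∀ y ∈ frontier Ω ∩ Metric.ball x (θ * r), -(ε * (θ * r)) ≤ inner ℝ σ (y - x) := by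
    intro y hy
    have := near' y hy
    rcases hσ with rfl | rfl
    · exact (abs_le.1 this).1
    · rw [inner_neg_left]; linarith [(abs_le.1 this).2]
  set S : Set (EuclideanSpace ℝ (Fin N)) :=
    Metric.ball x (θ * r) ∩ {y | inner ℝ σ (y - x) ≤ -(2 * ε * (θ * r))} with hS
  have hSc : IsPreconnected S := by
    refine ((convex_ball x (θ * r)).inter ?_).isPreconnected
    have : {y : EuclideanSpace ℝ (Fin N) | inner ℝ σ (y - x) ≤ -(2 * ε * (θ * r))} =
        {y | innerSL ℝ σ y ≤ -(2 * ε * (θ * r)) + inner ℝ σ x} := by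
      ext y
      simp only [mem_ofPred_eq, inner_sub_right, innerSL_apply_apply]
      constructor <;> intro h <;> linarith
    rw [this]
    exact convex_halfSpace_le (innerSL ℝ σ).isLinear _
  have hSf : ∀ y ∈ S, y ∉ frontier Ω := by
    intro y hy hyf
    have h4 := nearσ y ⟨hyf, hy.1⟩
    have h5 : inner ℝ σ (y - x) ≤ -(2 * ε * (θ * r)) := hy.2
    have : 0 < ε * (θ * r) := by positivity
    linarith
  set z := x - (θ * r / 2) • ν with hz
  have hzb : z ∈ Metric.ball x (θ * r) := by
    rw [Metric.mem_ball, dist_eq_norm, hz, sub_sub_cancel_left, norm_neg, norm_smul, hν,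
      Real.norm_of_nonneg (by positivity)]
    linarith
  have hzΩ : z ∉ Ω := fun h => by
    have h4 := hside z ⟨h, hsub hzb⟩
    rw [hz, sub_sub_cancel_left, inner_neg_right, inner_smul_right, hνν] at h4
    nlinarith
  have hzS : z ∈ S := by
    refine ⟨hzb, ?_⟩
    change inner ℝ σ (z - x) ≤ _
    rw [hz, sub_sub_cancel_left, inner_neg_right, inner_smul_right]
    have h4 : 2 * ε * (θ * r) ≤ 1 / 4 * (θ * r) :=
      mul_le_mul_of_nonneg_right (by linarith) hρ.le
    nlinarith
  intro y hy
  by_contra hne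
  exact hzΩ (subset_of_isPreconnected_of_disjoint_frontier hSc hΩ hSf
    (y := y) ⟨hy.2, not_lt.1 hne⟩ hy.1 hzS)

/-- In a Reifenberg-flat domain with `ε` small, `Ω` lies on one side of a hyperplane, up to a
small error, in all balls of radius `θ^k r₀` centred on the boundary. -/
theorem IsReifenbergFlatDomain.one_sided {ε θ : ℝ} (h : IsReifenbergFlatDomain ε r₀ Ω)
    (hθ : 0 < θ) (hθ1 : θ < 1) (hεθ : ε ≤ θ / 8) {x : EuclideanSpace ℝ (Fin N)}
    (hx : x ∈ frontier Ω) (k : ℕ) :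
    ∃ ν : EuclideanSpace ℝ (Fin N), ‖ν‖ = 1 ∧ ∀ y ∈ Ω ∩ Metric.ball x (θ ^ k * r₀),
      -(2 * ε * (θ ^ k * r₀)) < inner ℝ ν (y - x) := by
  obtain ⟨n, hn, hcap⟩ := h.flat
  have hr := h.radius_pos
  suffices ∃ ν, (ν = n x (θ ^ k * r₀) ∨ ν = -n x (θ ^ k * r₀)) ∧
      ∀ y ∈ Ω ∩ Metric.ball x (θ ^ k * r₀), -(2 * ε * (θ ^ k * r₀)) < inner ℝ ν (y - x) by
    obtain ⟨ν, h1, h2⟩ := this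
    have h3 := (hn x hx (θ ^ k * r₀) (by positivity)
      (mul_le_of_le_one_left hr.le (pow_le_one₀ hθ.le hθ1.le))).1
    refine ⟨ν, ?_, h2⟩
    rcases h1 with rfl | rfl
    · exact h3
    · rwa [norm_neg]
  induction k with
  | zero =>
    simp only [pow_zero, one_mul]
    have key : ∀ ν : EuclideanSpace ℝ (Fin N), cap x (-ν) r₀ (2 * ε * r₀) ⊆ Ωᶜ →
        ∀ y ∈ Ω ∩ Metric.ball x r₀, -(2 * ε * r₀) < inner ℝ ν (y - x) := by
      intro ν hν y hy
      by_contra hne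
      refine hν ⟨hy.2, ?_⟩ hy.1
      rw [mem_ofPred_eq, inner_neg_left]
      linarith [not_lt.1 hne]
    rcases hcap x hx with h1 | h1
    · exact ⟨_, Or.inl rfl, key _ h1.2⟩
    · exact ⟨_, Or.inr rfl, key _ (by rw [neg_neg]; exact h1.2)⟩
  | succ k ih =>
    obtain ⟨ν, hν, hside⟩ := ih
    have hk1 : θ ^ k * r₀ ≤ r₀ := mul_le_of_le_one_left hr.le (pow_le_one₀ hθ.le hθ1.le)
    obtain ⟨hn1, hn2⟩ := hn x hx (θ ^ k * r₀) (by positivity) hk1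
    have e1 : θ ^ (k + 1) * r₀ = θ * (θ ^ k * r₀) := by ring
    have hk2 : θ * (θ ^ k * r₀) ≤ r₀ := by
      refine le_trans ?_ hk1
      exact mul_le_of_le_one_left (by positivity) hθ1.le
    obtain ⟨hn1', hn2'⟩ := hn x hx (θ * (θ ^ k * r₀)) (by positivity) hk2
    rw [e1]
    have hν1 : ‖ν‖ = 1 := by
      rcases hν with rfl | rfl
      · exact hn1
      · rwa [norm_neg]
    have hnear := (flat_consequences h.eps_pos (by positivity) hx hn1 hn2).1
    refine one_sided_step h.eps_pos hθ hθ1 hεθ (by positivity) h.isOpen hx hν1 hn1'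
      (fun y hy => ?_) hside hn2'
    rcases hν with rfl | rfl
    · exact hnear y hy
    · rw [inner_neg_left, abs_neg]; exact hnear y hy

/-! ### Decay at the boundary -/

theorem setIntegral_abs_le_of_isPreciseRep {v : EuclideanSpace ℝ (Fin N) → ℝ}
    (hv : IsPreciseRep Ω u v) (hΩ : MeasurableSet Ω) {M r : ℝ} (hr : 0 < r)
    (hM0 : 0 ≤ M) {x₀ : EuclideanSpace ℝ (Fin N)}
    (hM : ∀ y ∈ Ω ∩ Metric.ball x₀ r, |v y| ≤ M) :
    ∫ y in Ω ∩ Metric.ball x₀ r, |u y| ≤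
      M * (volume.real (Metric.ball (0 : EuclideanSpace ℝ (Fin N)) 1) * r ^ N) := by
  have hvol : volume.real (Metric.ball x₀ r) =
      volume.real (Metric.ball (0 : EuclideanSpace ℝ (Fin N)) 1) * r ^ N := by
    rw [measureReal_def, Measure.addHaar_ball_of_pos volume x₀ hr, ENNReal.toReal_mul,
      ENNReal.toReal_ofReal (by positivity), measureReal_def]
    simp [mul_comm]
  have hfin : volume (Ω ∩ Metric.ball x₀ r) < ⊤ :=
    (measure_mono inter_subset_right).trans_lt measure_ball_lt_top
  have h1 : ‖∫ y in Ω ∩ Metric.ball x₀ r, |u y|‖ ≤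
      M * volume.real (Ω ∩ Metric.ball x₀ r) := by
    refine norm_setIntegral_le_of_norm_le_const_ae hfin ?_
    filter_upwards [ae_restrict_of_ae_restrict_of_subset inter_subset_left hv.ae_eq,
      ae_restrict_mem (hΩ.inter Metric.isOpen_ball.measurableSet)] with y hy hy'
    rw [← hy, Real.norm_eq_abs, abs_abs]
    exact hM y hy'
  refine (le_abs_self _).trans (h1.trans (mul_le_mul_of_nonneg_left ?_ hM0))
  rw [← hvol]
  exact measureReal_mono inter_subset_right measure_ball_lt_top.ne

/-- Improvement at a smaller scale: if `Ω` lies on one side of a hyperplane in `B(x₀, r)` and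
`|v| ≤ M` there, then `|v|` is of the order of `(θ + 2ε) M` in `B(x₀, θr)`, up to the contribution
of the right-hand side. -/
theorem MorreyData.decay_step (hN : 1 ≤ N) (D : MorreyData Ω u f r₀ γ Λ A)
    {v : EuclideanSpace ℝ (Fin N) → ℝ} (hv : IsPreciseRep Ω u v) {L : ℝ} (hL0 : 0 ≤ L)
    (hL : ∀ (s : ℝ), 0 < s → ∀ α : ℝ, 0 ≤ α → α ≤ 1 → ∀ x x' y : EuclideanSpace ℝ (Fin N),
      |avgKer s x y - avgKer s x' y| ≤ L * (s ^ N)⁻¹ * (dist x x' / s) ^ α)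
    {θ ε r M : ℝ} (hθ : θ ≤ 1 / 8) (hε : 0 < ε) (hεθ : ε ≤ 1 / 16) (hr : 0 < r)
    (hrr : r ≤ r₀) (hM0 : 0 ≤ M) {x₀ ν : EuclideanSpace ℝ (Fin N)} (hν : ‖ν‖ = 1)
    (hside : ∀ y ∈ Ω ∩ Metric.ball x₀ r, -(2 * ε * r) < inner ℝ ν (y - x₀))
    (hM : ∀ y ∈ Ω ∩ Metric.ball x₀ r, |v y| ≤ M) {x : EuclideanSpace ℝ (Fin N)}
    (hxΩ : x ∈ Ω) (hx : dist x x₀ < θ * r) :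
    |v x| ≤ (8 * 4 ^ N * L * volume.real (Metric.ball (0 : EuclideanSpace ℝ (Fin N)) 1)
      * (θ + 2 * ε) * M + Λ / γ * r ^ γ) / kerMass N := by
  set κ := volume.real (Metric.ball (0 : EuclideanSpace ℝ (Fin N)) 1) with hκ
  set τ : ℝ := inner ℝ ν (x - x₀) with hτ
  have hθr : θ * r ≤ 1 / 8 * r := mul_le_mul_of_nonneg_right hθ hr.le
  have hεr : ε * r ≤ 1 / 16 * r := mul_le_mul_of_nonneg_right hεθ hr.le
  have hεr0 : 0 < ε * r := by positivity
  have hτ1 : -(2 * ε * r) < τ := hside x ⟨hxΩ, Metric.mem_ball.2 (by linarith)⟩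
  have hτ2 : τ ≤ θ * r := by
    refine (le_abs_self _).trans ((abs_real_inner_le_norm _ _).trans ?_)
    rw [hν, one_mul, ← dist_eq_norm]; exact hx.le
  -- `x'` is the mirror image of `x` in the hyperplane at height `-2εr`.
  set σ : ℝ := τ + 2 * ε * r with hσ
  have hσ0 : 0 < σ := by linarith
  set x' := x - (2 * σ) • ν with hx'
  have hνν : inner ℝ ν ν = (1 : ℝ) := by rw [real_inner_self_eq_norm_sq, hν]; norm_num
  have hdist : dist x x' = 2 * σ := by
    rw [dist_eq_norm, hx', sub_sub_cancel, norm_smul, hν, mul_one,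
      Real.norm_of_nonneg (by linarith)]
  have hx'0 : dist x' x₀ ≤ 5 / 8 * r := by
    have := dist_triangle x' x x₀
    rw [dist_comm x' x, hdist] at this
    linarith
  have hfar : ∀ y, y ∉ Metric.ball x₀ r → r / 4 ≤ dist y x ∧ r / 4 ≤ dist y x' := by
    intro y hy
    rw [Metric.mem_ball, not_lt] at hy
    have h1 := dist_triangle y x x₀
    have h2 := dist_triangle y x' x₀
    constructor <;> linarith
  have hin' : ∀ y, inner ℝ ν (y - x') = inner ℝ ν (y - x₀) - τ + 2 * σ := by
    intro y
    have : y - x' = (y - x₀) - (x - x₀) + (2 * σ) • ν := by rw [hx']; abel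
    rw [this, inner_add_right, inner_sub_right, inner_smul_right, hνν, mul_one, ← hτ]
  have hσy : ∀ y ∈ Ω ∩ Metric.ball x₀ r, σ ≤ inner ℝ ν (y - x') := by
    intro y hy
    rw [hin' y]
    linarith [hside y hy]
  have hcloser : ∀ y ∈ Ω ∩ Metric.ball x₀ r, ‖y - x‖ ^ 2 ≤ ‖y - x'‖ ^ 2 := by
    intro y hy
    have h1 : y - x = (y - x') - (2 * σ) • ν := by rw [hx']; abel
    rw [h1, norm_sub_sq_real, inner_smul_right, real_inner_comm, norm_smul, hν, mul_one,
      Real.norm_of_nonneg (by linarith)]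
    nlinarith [hσy y hy]
  have hS : 0 < r / 4 := by positivity
  have hdom : ∀ s, 0 < s → s ≤ r / 4 → ∀ y ∈ Ω, 1 * potKer s x' y ≤ potKer s x y := by
    intro s hs hs4 y hy
    rw [one_mul]
    by_cases hyb : y ∈ Metric.ball x₀ r
    · exact mul_le_mul_of_nonneg_left (profile_antitone
        (mul_le_mul_of_nonneg_left (hcloser y ⟨hy, hyb⟩) (by positivity))) (by positivity)
    · rw [potKer_eq_zero hs (hs4.trans (hfar y hyb).2)]
      exact potKer_nonneg hs x y
  have hzero : ∀ s, 0 < s → s ≤ min σ (r / 4) → smoothAvg Ω (fun y => |u y|) x' s = 0 := by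
    intro s hs hs'
    refine setIntegral_eq_zero_of_forall_eq_zero fun y hy => ?_
    rw [avgKer_eq_zero hs, zero_mul]
    by_cases hyb : y ∈ Metric.ball x₀ r
    · refine (hs'.trans (min_le_left _ _)).trans ((hσy y ⟨hy, hyb⟩).trans ?_)
      refine (le_abs_self _).trans ((abs_real_inner_le_norm _ _).trans_eq ?_)
      rw [hν, one_mul, dist_eq_norm]
    · exact (hs'.trans (min_le_right _ _)).trans (hfar y hyb).2
  have hκ0 : 0 ≤ κ := measureReal_nonneg
  have htop : smoothAvg Ω (fun y => |u y|) x (r / 4) -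
      1 * smoothAvg Ω (fun y => |u y|) x' (r / 4) ≤ 8 * 4 ^ N * L * κ * (θ + 2 * ε) * M := by
    have i : ∀ z, IntegrableOn (fun y => avgKer (r / 4) z y * |u y|) Ω := fun z =>
      integrable_continuous_compact_mul D.integrable_u.abs (avgKer_contDiff _ z).continuous
        (avgKer_hasCompactSupport hS z)
    rw [one_mul, smoothAvg, smoothAvg, ← integral_sub (i x) (i x')]
    simp_rw [← sub_mul]
    have h1 := abs_setIntegral_mul_le (φ := fun y => avgKer (r / 4) x y - avgKer (r / 4) x' y)
      (b := L * ((r / 4) ^ N)⁻¹ * (dist x x' / (r / 4)) ^ (1 : ℝ)) D.isOpen.measurableSet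
      (Metric.isOpen_ball (x := x₀) (ε := r)).measurableSet D.integrable_u.abs
      (fun y _ => hL _ hS 1 zero_le_one le_rfl x x' y)
      (fun y _ hyb => by
        rw [avgKer_eq_zero hS (hfar y hyb).1, avgKer_eq_zero hS (hfar y hyb).2, sub_zero])
    simp only [abs_abs] at h1
    have h2 := setIntegral_abs_le_of_isPreciseRep hv D.isOpen.measurableSet hr hM0 hM
    refine (le_abs_self _).trans (h1.trans
      ((mul_le_mul_of_nonneg_left h2 (by positivity)).trans ?_))
    rw [hdist, Real.rpow_one, ← hκ]
    have h3 : L * ((r / 4) ^ N)⁻¹ * (2 * σ / (r / 4)) * (M * (κ * r ^ N)) =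
        8 * 4 ^ N * L * κ * (σ / r) * M := by
      rw [div_pow]; field_simp; ring
    rw [h3]
    have h4 : σ / r ≤ θ + 2 * ε := by rw [div_le_iff₀ hr]; linarith
    gcongr
  refine hv.abs_le hN ?_
  have hmin : 0 < min σ (r / 4) := lt_min hσ0 hS
  filter_upwards [Ioc_mem_nhdsGT hmin] with s hs
  have h1 := D.smoothAvg_sub_le zero_le_one hs.1 (hs.2.trans (min_le_right _ _))
    (by linarith) hdom
  rw [hzero s hs.1 hs.2, mul_zero, sub_zero] at h1
  have h2 : (r / 4) ^ γ ≤ r ^ γ :=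
    Real.rpow_le_rpow hS.le (by linarith) D.exponent_pos.le
  have h3 : Λ / γ * (r / 4) ^ γ ≤ Λ / γ * r ^ γ :=
    mul_le_mul_of_nonneg_left h2 (div_nonneg D.const_nonneg D.exponent_pos.le)
  linarith [abs_smoothAvg_le (Ω := Ω) (u := u) hs.1 x]

/-- Since `α < 1`, a linear gain in the ratio of the scales beats the power `θ^α`. -/
theorem exists_ratio {α : ℝ} (hα : α < 1) (c : ℝ) :
    ∃ θ : ℝ, 0 < θ ∧ θ ≤ 1 / 8 ∧ c * (2 * θ) ≤ θ ^ α / 2 := by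
  have h1 : Tendsto (fun θ : ℝ => 4 * c * θ ^ (1 - α)) (𝓝[>] 0) (𝓝 0) := by
    have h := (Real.continuousAt_rpow_const 0 (1 - α) (Or.inr (by linarith))).tendsto
    rw [Real.zero_rpow (by linarith)] at h
    simpa using (h.mono_left nhdsWithin_le_nhds).const_mul (4 * c)
  have h2 : ∀ᶠ θ in 𝓝[>] (0 : ℝ), 4 * c * θ ^ (1 - α) < 1 := h1.eventually (gt_mem_nhds one_pos)
  obtain ⟨θ, hθ, hθ'⟩ := (h2.and (Ioc_mem_nhdsGT (by norm_num : (0 : ℝ) < 1 / 8))).exists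
  have hθ0 : 0 < θ := hθ'.1
  refine ⟨θ, hθ0, hθ'.2, ?_⟩
  have h3 : θ = θ ^ (1 - α) * θ ^ α := by
    rw [← Real.rpow_add hθ0]; simp
  have h4 : 0 < θ ^ α := Real.rpow_pos_of_pos hθ0 α
  calc c * (2 * θ) = (4 * c * θ ^ (1 - α)) * (θ ^ α / 2) := by nth_rewrite 1 [h3]; ring
    _ ≤ 1 * (θ ^ α / 2) := mul_le_mul_of_nonneg_right hθ.le (by positivity)
    _ = _ := one_mul _

/-- Iteration of the decay step over the scales `θ^k r₀`: if each step gains the factor `θ^α / 2`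
up to an error of the order of `(θ^k r₀)^γ`, then `v` decays like the distance to the boundary
point to the power `α`. -/
theorem decay_of_step {v : EuclideanSpace ℝ (Fin N) → ℝ} {α θ E C₀ : ℝ} (hα : 0 < α)
    (hαγ : α ≤ γ) (hr : 0 < r₀) (hθ : 0 < θ) (hθ1 : θ < 1) (hE : 0 ≤ E)
    (hC₀ : ∀ x ∈ Ω, |v x| ≤ C₀) {x₀ : EuclideanSpace ℝ (Fin N)} (hx₀ : x₀ ∉ Ω)
    (hstep : ∀ (k : ℕ) (M : ℝ), 0 ≤ M → (∀ y ∈ Ω ∩ Metric.ball x₀ (θ ^ k * r₀), |v y| ≤ M) →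
      ∀ x ∈ Ω ∩ Metric.ball x₀ (θ ^ (k + 1) * r₀),
        |v x| ≤ θ ^ α / 2 * M + E * (θ ^ k * r₀) ^ γ)
    {x : EuclideanSpace ℝ (Fin N)} (hx : x ∈ Ω) :
    |v x| ≤ max C₀ (2 * E * r₀ ^ γ / θ ^ α) / (θ ^ 2 * r₀) ^ α * dist x x₀ ^ α := by
  set D₁ := max C₀ (2 * E * r₀ ^ γ / θ ^ α) with hD₁
  have hθα : 0 < θ ^ α := Real.rpow_pos_of_pos hθ α
  have hD0 : 0 ≤ D₁ := ((abs_nonneg _).trans (hC₀ x hx)).trans (le_max_left _ _)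
  have hDE : E * r₀ ^ γ ≤ θ ^ α / 2 * D₁ := by
    have h1 : 2 * E * r₀ ^ γ / θ ^ α ≤ D₁ := le_max_right _ _
    rw [div_le_iff₀ hθα] at h1
    linarith
  have claim : ∀ k : ℕ, ∀ y ∈ Ω ∩ Metric.ball x₀ (θ ^ k * r₀), |v y| ≤ D₁ * (θ ^ k) ^ α := by
    intro k
    induction k with
    | zero =>
      intro y hy
      simp only [pow_zero, Real.one_rpow, mul_one]
      exact (hC₀ y hy.1).trans (le_max_left _ _)
    | succ k ih =>
      intro y hy
      have hk : 0 < θ ^ k := pow_pos hθ k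
      have h1 := hstep k (D₁ * (θ ^ k) ^ α) (by positivity) ih y hy
      have h2 : (θ ^ k * r₀) ^ γ ≤ (θ ^ k) ^ α * r₀ ^ γ := by
        rw [Real.mul_rpow hk.le hr.le]
        exact mul_le_mul_of_nonneg_right
          (Real.rpow_le_rpow_of_exponent_ge hk (pow_le_one₀ hθ.le hθ1.le) hαγ) (by positivity)
      have h3 : (θ ^ (k + 1)) ^ α = (θ ^ k) ^ α * θ ^ α := by
        rw [pow_succ, Real.mul_rpow hk.le hθ.le]
      rw [h3]
      have h4 := mul_le_mul_of_nonneg_left h2 hE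
      have h5 := mul_le_mul_of_nonneg_left hDE (by positivity : 0 ≤ (θ ^ k) ^ α)
      linarith
  have hρ : 0 < dist x x₀ := dist_pos.2 fun h => hx₀ (h ▸ hx)
  have e1 : D₁ / (θ ^ 2 * r₀) ^ α * dist x x₀ ^ α = D₁ * (dist x x₀ / r₀ / θ ^ 2) ^ α := by
    rw [div_div, mul_comm r₀, Real.div_rpow hρ.le (by positivity)]; ring
  rw [e1]
  set t := dist x x₀ / r₀ with ht
  have ht0 : 0 < t := by positivity
  rcases le_or_gt θ t with h | h
  · refine ((hC₀ x hx).trans (le_max_left _ _)).trans (le_mul_of_one_le_right hD0 ?_)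
    refine Real.one_le_rpow ?_ hα.le
    rw [le_div_iff₀ (by positivity)]
    nlinarith
  · obtain ⟨n, hn1, hn2⟩ := exists_nat_pow_near_of_lt_one ht0 (h.le.trans hθ1.le) hθ hθ1
    obtain ⟨m, rfl⟩ : ∃ m, n = m + 1 := by
      refine Nat.exists_eq_succ_of_ne_zero fun h0 => ?_
      rw [h0, zero_add, pow_one] at hn1
      linarith
    have hm : 0 < θ ^ m := pow_pos hθ m
    have hxm : x ∈ Ω ∩ Metric.ball x₀ (θ ^ m * r₀) := by
      refine ⟨hx, ?_⟩
      rw [Metric.mem_ball, ← div_lt_iff₀ hr, ← ht]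
      refine hn2.trans_lt ?_
      rw [pow_succ]
      exact mul_lt_of_lt_one_right hm hθ1
    refine (claim m x hxm).trans (mul_le_mul_of_nonneg_left ?_ hD0)
    refine Real.rpow_le_rpow hm.le ?_ hα.le
    rw [le_div_iff₀ (by positivity)]
    refine le_of_eq_of_le ?_ hn1.le
    ring

/-! ### Hölder continuity -/

theorem mul_rpow_le_mul {c δ α : ℝ} (hc : 1 ≤ c) (hδ : 0 ≤ δ) (hα : α ≤ 1) :
    (c * δ) ^ α ≤ c * δ ^ α := by
  rw [Real.mul_rpow (by linarith) hδ]
  refine mul_le_mul_of_nonneg_right ?_ (by positivity)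
  simpa using Real.rpow_le_rpow_of_exponent_le hc hα

/-- Decay at the boundary and the interior estimate give a Hölder estimate in `Ω`: points that are
close to each other compared with their distance to the boundary are treated by the interior
estimate in a ball of comparable radius, the others by the decay. -/
theorem MorreyData.holder_of_decay (hN : 1 ≤ N) (D : MorreyData Ω u f r₀ γ Λ A)
    {v : EuclideanSpace ℝ (Fin N) → ℝ} (hv : IsPreciseRep Ω u v) {L : ℝ} (hL0 : 0 ≤ L)
    (hL : ∀ (s : ℝ), 0 < s → ∀ α : ℝ, 0 ≤ α → α ≤ 1 → ∀ x x' y : EuclideanSpace ℝ (Fin N),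
      |potKer s x y - potKer s x' y| ≤ L * (s ^ N)⁻¹ * (dist x x' / s) ^ α ∧
      |avgKer s x y - avgKer s x' y| ≤ L * (s ^ N)⁻¹ * (dist x x' / s) ^ α)
    {α C₀ B : ℝ} (hα : 0 < α) (hα1 : α ≤ 1) (hαγ : α < γ) (hB : 0 ≤ B)
    (hC₀ : ∀ x ∈ Ω, |v x| ≤ C₀) (hne : (frontier Ω).Nonempty)
    (hdecay : ∀ x ∈ Ω, ∀ x₀ ∈ frontier Ω, |v x| ≤ B * dist x x₀ ^ α)
    {y z : EuclideanSpace ℝ (Fin N)} (hy : y ∈ Ω) (hz : z ∈ Ω) (hyz : dist y z < r₀ / 4) :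
    |v y - v z| ≤ (9 * B + (L * 2 ^ N *
      volume.real (Metric.ball (0 : EuclideanSpace ℝ (Fin N)) 1) * (6 * B + C₀ * (4 / r₀) ^ α)
        + 2 * L * Λ / (γ - α) * r₀ ^ (γ - α)) / kerMass N) * dist y z ^ α := by
  set κ := volume.real (Metric.ball (0 : EuclideanSpace ℝ (Fin N)) 1) with hκ
  have hκ0 : 0 ≤ κ := measureReal_nonneg
  have hm := kerMass_pos hN
  have hr := D.radius_pos
  have hΛ := D.const_nonneg
  have hC₀0 : 0 ≤ C₀ := (abs_nonneg _).trans (hC₀ y hy)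
  have hγα : 0 < γ - α := sub_pos.2 hαγ
  set δ := dist y z with hδ
  have hδ0 : 0 ≤ δ := dist_nonneg
  have hδα : 0 ≤ δ ^ α := by positivity
  set K := L * 2 ^ N * κ * (6 * B + C₀ * (4 / r₀) ^ α)
    + 2 * L * Λ / (γ - α) * r₀ ^ (γ - α) with hK
  have hK0 : 0 ≤ K := by positivity
  obtain ⟨x₀, hx₀, hdx₀⟩ := isClosed_frontier.exists_infDist_eq_dist hne y
  set d := dist y x₀ with hd
  rcases le_or_gt d (4 * δ) with hcase | hcase
  · have h1 : |v y| ≤ B * (4 * δ ^ α) :=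
      (hdecay y hy x₀ hx₀).trans (mul_le_mul_of_nonneg_left
        ((Real.rpow_le_rpow dist_nonneg hcase hα.le).trans
          (mul_rpow_le_mul (by norm_num) hδ0 hα1)) hB)
    have h2 : |v z| ≤ B * (5 * δ ^ α) := by
      refine (hdecay z hz x₀ hx₀).trans (mul_le_mul_of_nonneg_left
        ((Real.rpow_le_rpow dist_nonneg ?_ hα.le).trans
          (mul_rpow_le_mul (by norm_num) hδ0 hα1)) hB)
      have := dist_triangle z y x₀
      rw [dist_comm z y] at this
      linarith
    have h3 : 0 ≤ K / kerMass N * δ ^ α := by positivity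
    calc |v y - v z| ≤ |v y| + |v z| := abs_sub _ _
      _ ≤ 9 * B * δ ^ α := by linarith
      _ ≤ _ := by rw [add_mul]; linarith
  · -- The interior case: the estimate is applied in balls of radius `ρ`.
    set ρ := min d r₀ / 4 with hρ
    have hδρ : δ < ρ := by
      rw [hρ, lt_div_iff₀ (by norm_num)]
      exact lt_min (by linarith) (by linarith)
    have hρ0 : 0 < ρ := hδ0.trans_lt hδρ
    have hρd : 4 * ρ ≤ d := by rw [hρ]; linarith [min_le_left d r₀]
    have hρr : 4 * ρ ≤ r₀ := by rw [hρ]; linarith [min_le_right d r₀]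
    have hball : Metric.ball y d ⊆ Ω := by
      refine subset_of_isPreconnected_of_disjoint_frontier
        (convex_ball y d).isPreconnected D.isOpen (fun w hw hwf => ?_)
        (Metric.mem_ball_self (by linarith)) hy
      have h1 := Metric.infDist_le_dist_of_mem hwf (x := y)
      rw [hdx₀, dist_comm y w] at h1
      exact absurd (Metric.mem_ball.1 hw) (not_lt.2 h1)
    have hby : Metric.closedBall y ρ ⊆ Ω :=
      (Metric.closedBall_subset_ball (by linarith)).trans hball
    have hbz : Metric.closedBall z ρ ⊆ Ω := by
      refine Subset.trans (fun w hw => ?_) hball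
      have h1 := dist_triangle w z y
      rw [Metric.mem_closedBall] at hw
      rw [dist_comm z y] at h1
      rw [Metric.mem_ball]; linarith
    set B' := 6 * B + C₀ * (4 / r₀) ^ α with hB'
    have hsup : ∀ w ∈ Ω ∩ Metric.ball y (2 * ρ), |v w| ≤ B' * ρ ^ α := by
      intro w hw
      have hwy := Metric.mem_ball.1 hw.2
      have hp1 : 0 ≤ 6 * B * ρ ^ α := by positivity
      have hp2 : 0 ≤ C₀ * (4 / r₀) ^ α * ρ ^ α := by positivity
      rw [hB', add_mul]
      rcases le_total d r₀ with h | h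
      · have hρ' : d = 4 * ρ := by rw [hρ, min_eq_left h]; ring
        have h1 : |v w| ≤ B * (6 * ρ ^ α) := by
          refine (hdecay w hw.1 x₀ hx₀).trans (mul_le_mul_of_nonneg_left
            ((Real.rpow_le_rpow dist_nonneg ?_ hα.le).trans
              (mul_rpow_le_mul (by norm_num) hρ0.le hα1)) hB)
          linarith [dist_triangle w y x₀]
        linarith
      · have hρ' : 4 / r₀ * ρ = 1 := by rw [hρ, min_eq_right h]; field_simp
        rw [mul_assoc C₀, ← Real.mul_rpow (by positivity) hρ0.le, hρ', Real.one_rpow, mul_one]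
        linarith [hC₀ w hw.1]
    have htop : |smoothAvg Ω u y ρ - smoothAvg Ω u z ρ| ≤ L * 2 ^ N * κ * B' * δ ^ α := by
      have i : ∀ z, IntegrableOn (fun y => avgKer ρ z y * u y) Ω := fun z =>
        integrable_continuous_compact_mul D.integrable_u (avgKer_contDiff _ z).continuous
          (avgKer_hasCompactSupport hρ0 z)
      rw [smoothAvg, smoothAvg, ← integral_sub (i y) (i z)]
      simp_rw [← sub_mul]
      have h1 := abs_setIntegral_mul_le (φ := fun w => avgKer ρ y w - avgKer ρ z w)
        (b := L * (ρ ^ N)⁻¹ * (δ / ρ) ^ α) D.isOpen.measurableSet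
        (Metric.isOpen_ball (x := y) (ε := 2 * ρ)).measurableSet D.integrable_u
        (fun w _ => (hL _ hρ0 α hα.le hα1 y z w).2)
        (fun w _ hw => by
          rw [Metric.mem_ball, not_lt] at hw
          have h2 := dist_triangle w z y
          rw [dist_comm z y] at h2
          rw [avgKer_eq_zero hρ0 (by linarith), avgKer_eq_zero hρ0 (by linarith), sub_zero])
      have h2 := setIntegral_abs_le_of_isPreciseRep hv D.isOpen.measurableSet
        (by positivity) (by positivity) hsup
      refine h1.trans ((mul_le_mul_of_nonneg_left h2 (by positivity)).trans_eq ?_)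
      rw [Real.div_rpow hδ0 hρ0.le, mul_pow, ← hκ]
      have : ρ ^ α ≠ 0 := by positivity
      field_simp
    have hfin := hv.abs_sub_le hN (x := y) (x' := z) (b := K * δ ^ α) (by
      filter_upwards [Ioc_mem_nhdsGT hρ0] with s hs
      have h1 := D.abs_smoothAvg_sub_le hL0
        (fun s hs a h0 h1 x x' y => (hL s hs a h0 h1 x x' y).1) hα.le hα1 hαγ hs.1 hs.2
        (by linarith) hby hbz
      refine h1.trans ?_
      have h2 : ρ ^ (γ - α) ≤ r₀ ^ (γ - α) :=
        Real.rpow_le_rpow hρ0.le (by linarith) hγα.le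
      have h3 : 2 * L * Λ * δ ^ α / (γ - α) * ρ ^ (γ - α) ≤
          2 * L * Λ * δ ^ α / (γ - α) * r₀ ^ (γ - α) :=
        mul_le_mul_of_nonneg_left h2 (by positivity)
      refine (add_le_add htop h3).trans_eq ?_
      rw [hK]; ring)
    have h3 : 0 ≤ 9 * B * δ ^ α := by positivity
    calc |v y - v z| ≤ K * δ ^ α / kerMass N := hfin
      _ ≤ 9 * B * δ ^ α + K * δ ^ α / kerMass N := le_add_of_nonneg_left h3
      _ = (9 * B + K / kerMass N) * δ ^ α := by ring

/-! ### Local mass bounds from Lebesgue norms -/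

/-- Hölder's inequality on balls. -/
theorem setIntegral_abs_le_eLpNorm {q : ℝ≥0∞} (hq : 1 ≤ q)
    (hf : MemLp f q (volume.restrict Ω)) (x : EuclideanSpace ℝ (Fin N)) {R : ℝ} (hR : 0 < R) :
    ∫ y in Ω ∩ Metric.ball x R, |f y| ≤ (eLpNorm f q (volume.restrict Ω)).toReal *
      (volume.real (Metric.ball (0 : EuclideanSpace ℝ (Fin N)) 1) * R ^ N)
        ^ (1 - (q⁻¹).toReal) := by
  set κ := volume.real (Metric.ball (0 : EuclideanSpace ℝ (Fin N)) 1) with hκ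
  have hvol : volume.real (Metric.ball x R) = κ * R ^ N := by
    rw [measureReal_def, Measure.addHaar_ball_of_pos volume x hR, ENNReal.toReal_mul,
      ENNReal.toReal_ofReal (by positivity), hκ, measureReal_def]
    simp [mul_comm]
  set μ := volume.restrict (Ω ∩ Metric.ball x R) with hμ
  have hle : μ ≤ volume.restrict Ω := Measure.restrict_mono inter_subset_left le_rfl
  have hμu : μ univ ≤ ENNReal.ofReal (κ * R ^ N) := by
    rw [hμ, Measure.restrict_apply_univ, ← hvol, ofReal_measureReal measure_ball_lt_top.ne]
    exact measure_mono inter_subset_right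
  have hexp : 0 ≤ 1 - (q⁻¹).toReal := by
    have : (q⁻¹).toReal ≤ (1 : ℝ≥0∞).toReal :=
      ENNReal.toReal_mono ENNReal.one_ne_top (ENNReal.inv_le_one.2 hq)
    simpa using this
  have h1 := eLpNorm_le_eLpNorm_mul_rpow_measure_univ (μ := μ) hq (hf.1.mono_measure hle)
  have e1 : 1 / (1 : ℝ≥0∞).toReal - 1 / q.toReal = 1 - (q⁻¹).toReal := by
    rw [ENNReal.toReal_inv]; simp
  rw [e1] at h1
  have h2 : eLpNorm f 1 μ ≤ eLpNorm f q (volume.restrict Ω) *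
      ENNReal.ofReal ((κ * R ^ N) ^ (1 - (q⁻¹).toReal)) := by
    refine h1.trans (mul_le_mul' (eLpNorm_mono_measure f hle) ?_)
    rw [← ENNReal.ofReal_rpow_of_nonneg (by positivity) hexp]
    exact ENNReal.rpow_le_rpow hμu hexp
  have h3 : ∫ y, |f y| ∂μ = (eLpNorm f 1 μ).toReal := by
    rw [eLpNorm_one_eq_lintegral_enorm]
    exact integral_norm_eq_lintegral_enorm (hf.1.mono_measure hle)
  rw [h3]
  refine (ENNReal.toReal_mono (ENNReal.mul_ne_top hf.2.ne ENNReal.ofReal_ne_top) h2).trans_eq ?_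
  rw [ENNReal.toReal_mul, ENNReal.toReal_ofReal (by positivity)]

/-- Weak solutions with data in Lebesgue spaces satisfy the local bounds of `MorreyData`, with
constants that depend only on `p₀` and not on `p` and `q`. -/
theorem morreyData_of_memLp {p q p₀ : ℝ≥0∞} (hp : 1 ≤ p) (hq : 1 ≤ q)
    (hp₀ : 1 ≤ p₀) (hpq : p⁻¹ + q⁻¹ = p₀⁻¹) (hr : 0 < r₀) (ho : IsOpen Ω)
    (hb : Bornology.IsBounded Ω) (hw : IsWeakSolution Ω f u)
    (hγ : 0 < 2 - (N : ℝ) * (p₀⁻¹).toReal)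
    (hu : MemLp u p (volume.restrict Ω)) (hf : MemLp f q (volume.restrict Ω)) :
    MorreyData Ω u f r₀ (2 - (N : ℝ) * (p₀⁻¹).toReal)
      ((eLpNorm f q (volume.restrict Ω)).toReal *
        (volume.real (Metric.ball (0 : EuclideanSpace ℝ (Fin N)) 1) ^ (1 - (p₀⁻¹).toReal) *
          max 1 (volume.real (Metric.ball (0 : EuclideanSpace ℝ (Fin N)) 1) * r₀ ^ N)))
      ((eLpNorm u p (volume.restrict Ω)).toReal *
        max 1 (volume.real (Metric.ball (0 : EuclideanSpace ℝ (Fin N)) 1) * r₀ ^ N)) := by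
  have : IsFiniteMeasure (volume.restrict Ω) := ⟨by
    rw [Measure.restrict_apply_univ]; exact hb.measure_lt_top⟩
  set κ := volume.real (Metric.ball (0 : EuclideanSpace ℝ (Fin N)) 1) with hκ
  have hκ0 : 0 < κ :=
    ENNReal.toReal_pos (Metric.measure_ball_pos volume _ one_pos).ne' measure_ball_lt_top.ne
  have hbd : ∀ {s : ℝ≥0∞}, 1 ≤ s → 0 ≤ (s⁻¹).toReal ∧ (s⁻¹).toReal ≤ 1 ∧ s⁻¹ ≠ ⊤ := by
    intro s hs
    have h1 := ENNReal.inv_le_one.2 hs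
    refine ⟨ENNReal.toReal_nonneg, ?_, (h1.trans_lt ENNReal.one_lt_top).ne⟩
    simpa using ENNReal.toReal_mono ENNReal.one_ne_top h1
  obtain ⟨p0, p1, pt⟩ := hbd hp
  obtain ⟨q0, q1, qt⟩ := hbd hq
  obtain ⟨-, b1, -⟩ := hbd hp₀
  have hsum : (p₀⁻¹).toReal = (p⁻¹).toReal + (q⁻¹).toReal := by
    rw [← hpq, ENNReal.toReal_add pt qt]
  have hpow : ∀ t e : ℝ, 0 ≤ t → t ≤ κ * r₀ ^ N → 0 ≤ e → e ≤ 1 →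
      t ^ e ≤ max 1 (κ * r₀ ^ N) := by
    intro t e ht ht' he he'
    calc t ^ e ≤ (max 1 (κ * r₀ ^ N)) ^ e :=
          Real.rpow_le_rpow ht (ht'.trans (le_max_right _ _)) he
      _ ≤ (max 1 (κ * r₀ ^ N)) ^ (1 : ℝ) :=
          Real.rpow_le_rpow_of_exponent_le (le_max_left _ _) he'
      _ = _ := Real.rpow_one _
  refine ⟨ho, hb, hw, hu.integrable hp, hf.integrable hq, hr, hγ, by positivity,
    fun x R hR hRr => ?_, fun x => ?_⟩
  · refine (setIntegral_abs_le_eLpNorm hq hf x hR).trans ?_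
    rw [mul_assoc]
    refine mul_le_mul_of_nonneg_left ?_ ENNReal.toReal_nonneg
    rw [← hκ]
    have hpos : 0 < κ * R ^ N := by positivity
    have e1 : 1 - (q⁻¹).toReal = (1 - (p₀⁻¹).toReal) + (p⁻¹).toReal := by rw [hsum]; ring
    rw [e1, Real.rpow_add hpos]
    have e2 : (κ * R ^ N) ^ (1 - (p₀⁻¹).toReal) =
        κ ^ (1 - (p₀⁻¹).toReal) * R ^ ((N : ℝ) - 2 + (2 - (N : ℝ) * (p₀⁻¹).toReal)) := by
      rw [Real.mul_rpow hκ0.le (by positivity), ← Real.rpow_natCast, ← Real.rpow_mul hR.le]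
      congr 2; ring
    have e3 : (κ * R ^ N) ^ (p⁻¹).toReal ≤ max 1 (κ * r₀ ^ N) :=
      hpow _ _ hpos.le (by gcongr) p0 p1
    rw [e2]
    calc _ ≤ κ ^ (1 - (p₀⁻¹).toReal) *
          R ^ ((N : ℝ) - 2 + (2 - (N : ℝ) * (p₀⁻¹).toReal)) * max 1 (κ * r₀ ^ N) :=
          mul_le_mul_of_nonneg_left e3 (by positivity)
      _ = _ := by ring
  · refine (setIntegral_abs_le_eLpNorm hp hu x hr).trans ?_
    refine mul_le_mul_of_nonneg_left ?_ ENNReal.toReal_nonneg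
    exact hpow _ _ (by positivity) le_rfl (by linarith) (by linarith)

/-! ### Estimate of the Hölder norm -/

theorem frontier_nonempty_of_isBounded (hN : 1 ≤ N) (hb : Bornology.IsBounded Ω)
    (hne : Ω.Nonempty) : (frontier Ω).Nonempty := by
  have : Nonempty (Fin N) := ⟨⟨0, hN⟩⟩
  have : Nontrivial (EuclideanSpace ℝ (Fin N)) := inferInstance
  refine nonempty_frontier_iff.2 ⟨hne, fun h => ?_⟩
  rw [h] at hb
  exact NormedSpace.unbounded_univ ℝ (EuclideanSpace ℝ (Fin N)) hb

/-- A pointwise bound and a pointwise Hölder estimate bound the norm of `C^{0,α}(S)`. -/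
theorem holderNormOn_le {α C₀ H : ℝ} (hα : 0 ≤ α) (hH : 0 ≤ H)
    {S : Set (EuclideanSpace ℝ (Fin N))}
    {v : EuclideanSpace ℝ (Fin N) → ℝ} (hC₀0 : 0 ≤ C₀) (hC₀ : ∀ y ∈ S, |v y| ≤ C₀)
    (h : ∀ y ∈ S, ∀ z ∈ S, |v y - v z| ≤ H * dist y z ^ α) :
    holderNormOn α S v ≤ ENNReal.ofReal (C₀ + H) := by
  rw [holderNormOn, ENNReal.ofReal_add hC₀0 hH]
  refine add_le_add ?_ ?_
  · refine iSup₂_le fun y hy => ?_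
    rw [← ofReal_norm]
    exact ENNReal.ofReal_le_ofReal (hC₀ y hy)
  · have hw : HolderWith H.toNNReal α.toNNReal (S.domRestrict v) := by
      rintro ⟨y, hy⟩ ⟨z, hz⟩
      rw [edist_dist, edist_dist, ENNReal.ofReal_rpow_of_nonneg dist_nonneg (by positivity),
        Real.coe_toNNReal α hα]
      change _ ≤ ENNReal.ofReal H * _
      rw [← ENNReal.ofReal_mul hH]
      exact ENNReal.ofReal_le_ofReal (h y hy z hz)
    exact hw.eHolderNorm_le

/-- The Hölder estimate for `α < 1`, with a constant for each choice of `r₀`, `p₀` and of the two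
Lebesgue norms. The flatness parameter is `ε = θ / 8`, with `θ` the ratio of consecutive scales. -/
theorem exists_holder_bound (hN : 1 ≤ N) {α : ℝ} (hα : 0 < α) (hα1 : α < 1) :
    ∃ ε : ℝ, 0 < ε ∧ ε < 1 / 2 ∧ ∀ (r₀ : ℝ) (p₀ : ℝ≥0∞) (U F : ℝ), ∃ C : ℝ,
      ∀ p q : ℝ≥0∞, 1 ≤ p → 1 ≤ q → 1 ≤ p₀ → p⁻¹ + q⁻¹ = p₀⁻¹ →
      α < 1 - (N : ℝ) / 2 * (p₀⁻¹).toReal →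
      ∀ Ω : Set (EuclideanSpace ℝ (Fin N)), IsReifenbergFlatDomain ε r₀ Ω →
      ∀ u f : EuclideanSpace ℝ (Fin N) → ℝ, IsWeakSolution Ω f u →
      MemLp u p (volume.restrict Ω) → MemLp f q (volume.restrict Ω) →
      (eLpNorm u p (volume.restrict Ω)).toReal = U →
      (eLpNorm f q (volume.restrict Ω)).toReal = F →
      ∃ v : EuclideanSpace ℝ (Fin N) → ℝ,
        v =ᵐ[volume.restrict Ω] u ∧ (∀ y ∈ frontier Ω, v y = 0) ∧
        ∀ x ∈ closure Ω,
          holderNormOn α (Metric.ball x (r₀ / 12) ∩ closure Ω) v ≤ ENNReal.ofReal C := by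
  obtain ⟨L, hL1, hL2, hL3⟩ := exists_kernel_bound N
  have hL0 : 0 ≤ L := by linarith
  have hm := kerMass_pos hN
  set κ := volume.real (Metric.ball (0 : EuclideanSpace ℝ (Fin N)) 1) with hκ
  have hκ0 : 0 ≤ κ := measureReal_nonneg
  obtain ⟨θ, hθ, hθ8, hθα⟩ := exists_ratio hα1 (8 * 4 ^ N * L * κ / kerMass N)
  refine ⟨θ / 8, by positivity, by linarith, fun r₀ p₀ U F => ?_⟩
  set γ := 2 - (N : ℝ) * (p₀⁻¹).toReal with hγ
  set Λ := F * (κ ^ (1 - (p₀⁻¹).toReal) * max 1 (κ * r₀ ^ N)) with hΛ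
  set A := U * max 1 (κ * r₀ ^ N) with hA
  set C₀ := (L * (r₀ ^ N)⁻¹ * A + Λ / γ * r₀ ^ γ) / kerMass N with hC₀
  set B := max C₀ (2 * (Λ / γ / kerMass N) * r₀ ^ γ / θ ^ α) / (θ ^ 2 * r₀) ^ α with hB
  set H := 9 * B + (L * 2 ^ N * κ * (6 * B + C₀ * (4 / r₀) ^ α)
        + 2 * L * Λ / (γ - α) * r₀ ^ (γ - α)) / kerMass N with hH
  refine ⟨C₀ + H, fun p q hp hq hp₀ hpq hαp Ω hΩ u f hw hu hf hU hF => ?_⟩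
  have hαγ : 2 * α < γ := by rw [hγ]; linarith
  have hr := hΩ.radius_pos
  have D : MorreyData Ω u f r₀ γ Λ A := by
    have := morreyData_of_memLp hp hq hp₀ hpq hr hΩ.isOpen hΩ.isBounded hw
      (by linarith) hu hf
    rwa [hU, hF] at this
  have hΛ0 := D.const_nonneg
  have hγ0 := D.exponent_pos
  obtain ⟨v, hv⟩ := D.exists_isPreciseRep hN
  have hsup : ∀ x, |v x| ≤ C₀ := fun x => hv.abs_le hN (by
    filter_upwards [Ioc_mem_nhdsGT hr] with s hs
    exact (abs_smoothAvg_le hs.1 x).trans (D.smoothAvg_abs_le hL2 hL0 hs.1 hs.2 x))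
  have hC₀0 : 0 ≤ C₀ := (abs_nonneg _).trans (hsup 0)
  have hE : 0 ≤ Λ / γ / kerMass N := by positivity
  have hB0 : 0 ≤ B := div_nonneg (hC₀0.trans (le_max_left _ _)) (by positivity)
  have hγα : 0 < γ - α := by linarith
  have hH0 : 0 ≤ H := by positivity
  have hnot : ∀ x₀ ∈ frontier Ω, x₀ ∉ Ω := fun x₀ h => by
    rw [hΩ.isOpen.frontier_eq] at h; exact h.2
  have hdecay : ∀ x ∈ Ω, ∀ x₀ ∈ frontier Ω, |v x| ≤ B * dist x x₀ ^ α := by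
    intro x hx x₀ hx₀
    refine decay_of_step hα (by linarith : α ≤ γ) hr hθ (by linarith) hE (fun x _ => hsup x)
      (hnot x₀ hx₀) (fun k M hM0 hM y hy => ?_) hx
    obtain ⟨ν, hν, hside⟩ := hΩ.one_sided hθ (by linarith) le_rfl hx₀ k
    have h1 := D.decay_step hN hv hL0 (fun s hs a h0 h1 x x' y => (hL3 s hs a h0 h1 x x' y).2)
      hθ8 hΩ.eps_pos (by linarith) (by positivity)
      (mul_le_of_le_one_left hr.le (pow_le_one₀ hθ.le (by linarith))) hM0 hν hside hM hy.1
      (by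
        have := Metric.mem_ball.1 hy.2
        rwa [pow_succ, mul_comm (θ ^ k), mul_assoc] at this)
    refine h1.trans ?_
    rw [add_div, ← hκ]
    refine add_le_add ?_ (le_of_eq (by ring))
    calc 8 * 4 ^ N * L * κ * (θ + 2 * (θ / 8)) * M / kerMass N
        = 8 * 4 ^ N * L * κ / kerMass N * (θ + 2 * (θ / 8)) * M := by ring
      _ ≤ 8 * 4 ^ N * L * κ / kerMass N * (2 * θ) * M := by
          gcongr
          linarith
      _ ≤ θ ^ α / 2 * M := mul_le_mul_of_nonneg_right hθα hM0
  have hfne := frontier_nonempty_of_isBounded hN hΩ.isBounded hΩ.isConnected.nonempty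
  refine ⟨Ω.indicator v, ?_, fun y hy => indicator_of_notMem (hnot y hy) v, fun x _ => ?_⟩
  · filter_upwards [hv.ae_eq, ae_restrict_mem hΩ.isOpen.measurableSet] with y hy hyΩ
    rw [indicator_of_mem hyΩ, hy]
  · have hBH : B ≤ H := by
      have : 0 ≤ (L * 2 ^ N * κ * (6 * B + C₀ * (4 / r₀) ^ α)
        + 2 * L * Λ / (γ - α) * r₀ ^ (γ - α)) / kerMass N := by positivity
      rw [hH]; linarith
    have hedge : ∀ y ∈ Ω, ∀ z ∈ frontier Ω, |v y| ≤ H * dist y z ^ α := fun y hy z hz =>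
      (hdecay y hy z hz).trans (mul_le_mul_of_nonneg_right hBH (by positivity))
    have hfr : ∀ y ∈ closure Ω, y ∉ Ω → y ∈ frontier Ω := fun y hy hy' => by
      rw [hΩ.isOpen.frontier_eq]; exact ⟨hy, hy'⟩
    refine holderNormOn_le hα.le hH0 hC₀0 (fun y _ => ?_) fun y hy z hz => ?_
    · by_cases h : y ∈ Ω
      · rw [indicator_of_mem h]; exact hsup y
      · rw [indicator_of_notMem h, abs_zero]; exact hC₀0
    · by_cases hyΩ : y ∈ Ω <;> by_cases hzΩ : z ∈ Ω
      · rw [indicator_of_mem hyΩ, indicator_of_mem hzΩ]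
        refine D.holder_of_decay hN hv hL0 hL3 hα hα1.le (by linarith) hB0 (fun x _ => hsup x)
          hfne hdecay hyΩ hzΩ ?_
        have h1 := Metric.mem_ball.1 hy.1
        have h2 := Metric.mem_ball.1 hz.1
        linarith [dist_triangle_right y z x]
      · rw [indicator_of_mem hyΩ, indicator_of_notMem hzΩ, sub_zero]
        exact hedge y hyΩ z (hfr z hz.2 hzΩ)
      · rw [indicator_of_notMem hyΩ, indicator_of_mem hzΩ, zero_sub, abs_neg, dist_comm]
        exact hedge z hzΩ y (hfr y hy.2 hyΩ)
      · rw [indicator_of_notMem hyΩ, indicator_of_notMem hzΩ, sub_zero, abs_zero]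
        positivity

end

theorem theorem1 (N : ℕ) (hN : 1 ≤ N) (α : ℝ) (hα : 0 < α) :
    ∃ ε : ℝ, 0 < ε ∧ ε < 1 / 2 ∧ ∃ C : ℝ → ℝ≥0∞ → ℝ → ℝ → ℝ,
      ∀ p q p₀ : ℝ≥0∞, 1 ≤ p → 1 ≤ q → 1 ≤ p₀ → p⁻¹ + q⁻¹ = p₀⁻¹ →
      (N : ℝ≥0∞) / 2 < p₀ → α < 1 - (N : ℝ) / 2 * (p₀⁻¹).toReal →
      ∀ (r₀ : ℝ) (Ω : Set (EuclideanSpace ℝ (Fin N))), IsReifenbergFlatDomain ε r₀ Ω →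
      ∀ u f : EuclideanSpace ℝ (Fin N) → ℝ, IsWeakSolution Ω f u →
      MemLp u p (volume.restrict Ω) → MemLp f q (volume.restrict Ω) →
      ∃ v : EuclideanSpace ℝ (Fin N) → ℝ,
        v =ᵐ[volume.restrict Ω] u ∧ (∀ y ∈ frontier Ω, v y = 0) ∧
        ∀ x ∈ closure Ω,
          MemHolderOn α (Metric.ball x (r₀ / 12) ∩ closure Ω) v ∧
          holderNormOn α (Metric.ball x (r₀ / 12) ∩ closure Ω) v ≤
            ENNReal.ofReal (C r₀ p₀ (eLpNorm u p (volume.restrict Ω)).toReal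
              (eLpNorm f q (volume.restrict Ω)).toReal) := by
  rcases lt_or_ge α 1 with hα1 | hα1
  · obtain ⟨ε, hε, hε2, h⟩ := exists_holder_bound hN hα hα1
    choose C hC using h
    refine ⟨ε, hε, hε2, C, fun p q p₀ hp hq hp₀ hpq _ hαp r₀ Ω hΩ u f hw hu hf => ?_⟩
    obtain ⟨v, hv1, hv2, hv3⟩ := hC r₀ p₀ _ _ p q hp hq hp₀ hpq hαp Ω hΩ u f hw hu hf rfl rfl
    exact ⟨v, hv1, hv2, fun x hx => ⟨(hv3 x hx).trans_lt ENNReal.ofReal_lt_top, hv3 x hx⟩⟩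
  · -- No exponent `p₀` is admissible when `α ≥ 1`.
    refine ⟨1 / 4, by norm_num, by norm_num, fun _ _ _ _ => 0,
      fun p q p₀ _ _ _ _ _ hαp => absurd hαp (not_lt.2 ?_)⟩
    have : 0 ≤ (N : ℝ) / 2 * (p₀⁻¹).toReal := by positivity
    linarith
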